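/- Let $m,M,n$ be positive integers and let $f_j^i:\mathbb{R}^n\to\mathbb{R}$ ($1\le i\le M$, $1\le j\le m$) be differentiable functions. Put $f_j=\frac1M\sum_{i=1}^M f_j^i$ and $f=\frac1m\sum_{j=1}^m f_j$. Let $\mathcal G$ be a connected graph on the nodes $\{1,\dots,m\}$ and let $W=(w_{il})\in\mathbb{R}^{m\times m}$ be a mixing matrix of $\mathcal G$: $w_{il}=0$ if $i\ne l$ and $\{i,l\}$ is not an edge, $w_{il}>0$ otherwise, $W=W^\top$, $\operatorname{null}(I-W)=\operatorname{span}\{\mathbf 1\}$, and $I\succeq W\succ -I$. Let $H$ be an irreducible, aperiodic $M\times M$ transition matrix whose stationary distribution is uniform on $\{1,\dots,M\}$. Each node $v$ runs a time-homogeneous Markov chain $(j_{v,k})_{k\ge0}$ on $\{1,\dots,M\}$ with transition matrix $H$ and arbitrary initial state, Markov with respect to the joint history of all nodes: $\mathbb{P}(j_{v,k+1}=t\mid (j_{u,i})_{u\le m,\,i\le k})=H_{j_{v,k},t}$ (for instance, the chains of different nodes are independent). Assume that every $f_j$ is bounded below, and that there are constants $B,L$ with $\|\nabla f_j^i(x)\|\le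 B$ and $\|\nabla f_j^i(x)-\nabla f_j^i(y)\|\le L\|x-y\|$ for all $i,j,x,y$. Let $\gamma_k=(k+1)^{-\theta}$ with $\frac12<\theta<1$. The decentralized Markov chain gradient descent (DMGD) iterates are given by $\mathbf{x}^0(v)=x^0$ for all $v$ and $$\mathbf{x}^{k+1}(v)=\sum_{l=1}^m w_{vl}\,\mathbf{x}^k(l)-\gamma_k\nabla f_v^{\,j_{v,k}}(\mathbf{x}^k(v)),\qquad 1\le v\le m,\ k\ge 0,$$ and $\overline{x^k}=\frac1m\sum_{v=1}^m\mathbf{x}^k(v)$. Then $$\lim_{k\to\infty}\mathbb{E}\|\nabla f(\overline{x^k})\|=0 .$$ Moreover, for a square matrix $A$ with simple dominant eigenvalue $1$ let $\rho(A)$ be the largest modulus of the remaining eigenvalues ($0$ if there are none), and put $\lambda(H)=\frac{\rho(H)+1}{2}$ and $\lambda_2(W)=\rho(W)$. Then $\lambda(H)\in[0,1)$ and, for every $k\ge1$, $$\min_{1\le i\le k}\mathbb{E}\|\nabla f(\overline{x^i})\|\le C\,\frac{\frac{1}{\ln(1/\lambda(H))}\cdot\frac{1}{1-\lambda_2(W)}}{k^{(1-\theta)/2}},$$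 where the constant $C$ depends only on $m$, $M$, $\theta$, $B$, $L$ and an upper bound $\Delta$ of $f(x^0)-\inf f$; in particular it does not depend on $\mathcal G$, $W$, $H$, the chains or $n$. -/

import Mathlib

open MeasureTheory Filter Topology

noncomputable section

namespace DMGD

/-- The parameter space `ℝⁿ` with its Euclidean norm. -/
abbrev Param (n : ℕ) : Type := EuclideanSpace ℝ (Fin n)

/-! ### The objective.  `f v s` is the `s`-th component function held by node `v`. -/

/-- The loss of node `v`: the average of its `M` component functions. -/
def localLoss {m M n : ℕ} (f : Fin m → Fin M → Param n → ℝ) (v : Fin m) (x : Param n) : ℝ :=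
  (1 / (M : ℝ)) * ∑ s, f v s x

/-- The global objective: the average of the losses of the `m` nodes. -/
def objective {m M n : ℕ} (f : Fin m → Fin M → Param n → ℝ) (x : Param n) : ℝ :=
  (1 / (m : ℝ)) * ∑ v, localLoss f v x

/-! ### The mixing matrix -/

/-- `W` is a mixing matrix for the graph `G`. -/
structure IsMixingMatrix {m : ℕ} (G : SimpleGraph (Fin m)) (W : Matrix (Fin m) (Fin m) ℝ) :
    Prop where
  zero_of_not_adj : ∀ i l, i ≠ l → ¬ G.Adj i l → W i l = 0
  pos_of_adj : ∀ i l, (i = l ∨ G.Adj i l) → 0 < W i l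
  symm : W.transpose = W
  null_space : LinearMap.ker (Matrix.toLin' (1 - W)) = Submodule.span ℝ {fun _ => (1 : ℝ)}
  le_one : (1 - W).PosSemidef
  neg_one_lt : (1 + W).PosDef

/-! ### The Markov chains -/

/-- `H` is a transition (row-stochastic) matrix. -/
def IsTransitionMatrix {M : ℕ} (H : Matrix (Fin M) (Fin M) ℝ) : Prop :=
  (∀ s t, 0 ≤ H s t) ∧ ∀ s, ∑ t, H s t = 1

/-- Every state can be reached from every state. -/
def IsIrreducible {M : ℕ} (H : Matrix (Fin M) (Fin M) ℝ) : Prop :=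
  ∀ s t, ∃ k : ℕ, 0 < (H ^ k) s t

/-- Every state has period one: `1` is the only common divisor of its return times. -/
def IsAperiodic {M : ℕ} (H : Matrix (Fin M) (Fin M) ℝ) : Prop :=
  ∀ s, ∀ d : ℕ, (∀ k : ℕ, 0 < (H ^ k) s s → d ∣ k) → d = 1

/-- The row vector `p` is stationary for `H`. -/
def IsStationary {M : ℕ} (H : Matrix (Fin M) (Fin M) ℝ) (p : Fin M → ℝ) : Prop :=
  Matrix.vecMul p H = p

/-- `j k v` is the state at time `k` of the chain run by node `v`.  Conditionally on the history
of all the nodes up to time `k`, the chain of each node moves according to `H`.  This says that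
each `j · v` is a time-homogeneous Markov chain with transition matrix `H`, with respect to the
joint history of the nodes; it holds in particular for independent chains with transition matrix
`H`.  Initial states are arbitrary. -/
structure IsMarkovSampling {m M : ℕ} {Ω : Type*} [MeasurableSpace Ω] (μ : Measure Ω)
    (H : Matrix (Fin M) (Fin M) ℝ) (j : ℕ → Fin m → Ω → Fin M) : Prop where
  measurable : ∀ k v, Measurable (j k v)
  markov : ∀ (k : ℕ) (a : ℕ → Fin m → Fin M) (v : Fin m) (t : Fin M),
    μ.real {ω | (∀ i ≤ k, ∀ u, j i u ω = a i u) ∧ j (k + 1) v ω = t} =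
      μ.real {ω | ∀ i ≤ k, ∀ u, j i u ω = a i u} * H (a k v) t

/-! ### Second eigenvalues -/

/-- The second largest modulus of the eigenvalues of a matrix that has the dominant eigenvalue
`1`: the largest modulus of its complex eigenvalues, listed with multiplicity, after one copy of
the eigenvalue `1` is removed (`0` for a one-by-one matrix). -/
def secondModulus {n : ℕ} (A : Matrix (Fin n) (Fin n) ℝ) : ℝ :=
  (((((A.map (algebraMap ℝ ℂ)).charpoly.roots.erase 1).map fun z => ‖z‖₊).sup : NNReal) : ℝ)

/-- `λ(H) = (max {|λ₂(H)|, |λ_min(H)|} + 1) / 2`. -/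
def mixingRate {M : ℕ} (H : Matrix (Fin M) (Fin M) ℝ) : ℝ :=
  (secondModulus H + 1) / 2

/-! ### The algorithm -/

/-- The stepsizes `γ_k = (k + 1)^(-θ)`. -/
def stepsize (θ : ℝ) (k : ℕ) : ℝ := 1 / ((k : ℝ) + 1) ^ θ

/-- The iterates along given sample trajectories: all nodes start from `x₀`, and at step `k` node
`v` averages with weights `W v ·` (which vanish outside the neighbours of `v` and `v` itself) and
takes a gradient step for its component `j k v`. -/
def iterate {m M n : ℕ} (W : Matrix (Fin m) (Fin m) ℝ) (γ : ℕ → ℝ)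
    (f : Fin m → Fin M → Param n → ℝ) (x₀ : Param n) (j : ℕ → Fin m → Fin M) :
    ℕ → Fin m → Param n
  | 0, _ => x₀
  | k + 1, v => (∑ l, W v l • iterate W γ f x₀ j k l) -
      γ k • gradient (f v (j k v)) (iterate W γ f x₀ j k v)

/-- The average of the local variables. -/
def nodeAverage {m n : ℕ} (x : Fin m → Param n) : Param n := (1 / (m : ℝ)) • ∑ v, x v

/-- The expected norm of the gradient of the objective at the node average of the `k`-th
iterate. -/
def expGradNorm {m M n : ℕ} {Ω : Type*} [MeasurableSpace Ω] (μ : Measure Ω)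
    (W : Matrix (Fin m) (Fin m) ℝ) (θ : ℝ) (f : Fin m → Fin M → Param n → ℝ) (x₀ : Param n)
    (j : ℕ → Fin m → Ω → Fin M) (k : ℕ) : ℝ :=
  ∫ ω, ‖gradient (objective f)
    (nodeAverage (iterate W (stepsize θ) f x₀ (fun i v => j i v ω) k))‖ ∂μ

end DMGD

end

/-
The network matrix and the transition matrix are both doubly stochastic and primitive, so the
spectral gap and Cayley-Hamilton make their powers converge geometrically to the averaging matrix
`J`, in a summable way quantified by the second modulus alone.

For the network this makes the distance of a node from the average at most a convolution of the
stepsizes with a summable kernel. For the chain, the Poisson equation `G - H G = 1 - J` has the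
solution `G = ∑ₖ (Hᵏ - J)`, and it rewrites the bias of the sampled gradients as a telescoping
term, increments of order `γ_k`, and noise of mean zero. The descent inequality along the averaged
iterates then yields `∑ γ_k (𝔼‖∇f‖)² < ∞`, with a bound of second order in the inverse spectral
gaps, and hence the rate. For the limit, consecutive expected norms differ by `O(γ_k)` and
`∑ γ_k³ < ∞`, so the cubes of the expected norms form a Cauchy sequence, whose limit is `0` because
`∑ γ_k = ∞`.
-/

noncomputable section

namespace DMGD

section NonnegativePowers

variable {ι : Type*} [Fintype ι] [DecidableEq ι] {A : Matrix ι ι ℝ}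

theorem pow_apply_nonneg (hA : ∀ s t, 0 ≤ A s t) (k : ℕ) (s t : ι) : 0 ≤ (A ^ k) s t := by
  induction k generalizing s with
  | zero => rw [pow_zero, Matrix.one_apply]; positivity
  | succ k ih =>
    rw [pow_succ', Matrix.mul_apply]
    exact Finset.sum_nonneg fun u _ => mul_nonneg (hA s u) (ih u)

theorem pow_add_apply_pos (hA : ∀ s t, 0 ≤ A s t) {k l : ℕ} {s t u : ι}
    (hst : 0 < (A ^ k) s t) (htu : 0 < (A ^ l) t u) : 0 < (A ^ (k + l)) s u := by
  rw [pow_add, Matrix.mul_apply]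
  exact Finset.sum_pos' (fun v _ => mul_nonneg (pow_apply_nonneg hA k s v)
    (pow_apply_nonneg hA l v u)) ⟨t, Finset.mem_univ t, mul_pos hst htu⟩

theorem exists_forall_ge_pow_apply_self_pos (hA : ∀ s t, 0 ≤ A s t) {s : ι}
    (hs : ∀ d : ℕ, (∀ k, 0 < (A ^ k) s s → d ∣ k) → d = 1) :
    ∃ K, ∀ k ≥ K, 0 < (A ^ k) s s := by
  let returnTimes : AddSubmonoid ℕ :=
    { carrier := {k | 0 < (A ^ k) s s}
      zero_mem' := by simp
      add_mem' := pow_add_apply_pos hA }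
  have hgcd : Nat.setGcd (returnTimes : Set ℕ) = 1 :=
    hs _ fun k hk => Nat.setGcd_dvd_of_mem (s := (returnTimes : Set ℕ)) hk
  obtain ⟨K, hK⟩ := Nat.exists_mem_closure_of_ge (returnTimes : Set ℕ)
  refine ⟨K, fun k hk => ?_⟩
  have hmem := hK k hk (by simp [hgcd])
  rwa [AddSubmonoid.closure_eq] at hmem

theorem exists_pow_pos_of_walk (hA : ∀ s t, 0 ≤ A s t) {G : SimpleGraph ι}
    (hAdj : ∀ s t, G.Adj s t → 0 < A s t) {s t : ι} (p : G.Walk s t) : 0 < (A ^ p.length) s t := by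
  induction p with
  | nil => simp
  | cons h p ih =>
    rw [SimpleGraph.Walk.length_cons, add_comm]
    exact pow_add_apply_pos hA (by simpa using hAdj _ _ h) ih

end NonnegativePowers

theorem IsIrreducible.isPrimitive {M : ℕ} {H : Matrix (Fin M) (Fin M) ℝ}
    (hirr : IsIrreducible H) (hap : IsAperiodic H) (hH : ∀ s t, 0 ≤ H s t) : H.IsPrimitive := by
  choose K hK using fun s => exists_forall_ge_pow_apply_self_pos hH (hap s)
  choose p hp using hirr
  refine ⟨hH, 1 + ∑ s, K s + ∑ s, ∑ t, p s t, by omega, fun s t => ?_⟩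
  have hKs : K s ≤ ∑ s, K s :=
    Finset.single_le_sum (fun _ _ => Nat.zero_le _) (Finset.mem_univ s)
  have hpst : p s t ≤ ∑ s, ∑ t, p s t :=
    (Finset.single_le_sum (f := p s) (fun _ _ => Nat.zero_le _) (Finset.mem_univ t)).trans
      (Finset.single_le_sum (f := fun s => ∑ t, p s t) (fun _ _ => Nat.zero_le _)
        (Finset.mem_univ s))
  have hpos := pow_add_apply_pos hH
    (hK s (1 + ∑ s, K s + ∑ s, ∑ t, p s t - p s t) (by omega)) (hp s t)
  rwa [Nat.sub_add_cancel (by omega)] at hpos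

theorem IsStationary.mem_doublyStochastic {M : ℕ} {H : Matrix (Fin M) (Fin M) ℝ}
    (hs : IsStationary H (fun _ => 1 / (M : ℝ))) (hH : IsTransitionMatrix H) :
    H ∈ doublyStochastic ℝ (Fin M) := by
  refine mem_doublyStochastic_iff_sum.2 ⟨hH.1, hH.2, fun t => ?_⟩
  have hM : (M : ℝ) ≠ 0 := Nat.cast_ne_zero.2 t.pos.ne'
  have hcol : (1 / (M : ℝ)) * ∑ s, H s t = 1 / (M : ℝ) := by
    simpa only [Matrix.vecMul, dotProduct, ← Finset.mul_sum] using congrFun hs t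
  exact mul_left_cancel₀ (one_div_ne_zero hM) (hcol.trans (mul_one _).symm)

namespace IsMixingMatrix

variable {m : ℕ} {G : SimpleGraph (Fin m)} {W : Matrix (Fin m) (Fin m) ℝ}

theorem apply_nonneg (hW : IsMixingMatrix G W) (i l : Fin m) : 0 ≤ W i l := by
  by_cases h : i = l ∨ G.Adj i l
  · exact (hW.pos_of_adj i l h).le
  · rw [not_or] at h
    exact (hW.zero_of_not_adj i l h.1 h.2).ge

theorem mem_doublyStochastic (hW : IsMixingMatrix G W) : W ∈ doublyStochastic ℝ (Fin m) := by
  have hker : (1 : Fin m → ℝ) ∈ LinearMap.ker (Matrix.toLin' (1 - W)) :=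
    hW.null_space.ge (Submodule.mem_span_singleton_self _)
  have hone : W.mulVec 1 = 1 := by
    rw [LinearMap.mem_ker, Matrix.toLin'_apply, Matrix.sub_mulVec, Matrix.one_mulVec,
      sub_eq_zero] at hker
    exact hker.symm
  refine _root_.mem_doublyStochastic.2 ⟨hW.apply_nonneg, hone, ?_⟩
  rw [← Matrix.mulVec_transpose, hW.symm, hone]

theorem isPrimitive (hW : IsMixingMatrix G W) (hG : G.Connected) : W.IsPrimitive := by
  have hirr : IsIrreducible W := fun s t =>
    let ⟨p⟩ := hG.preconnected s t
    ⟨p.length, exists_pow_pos_of_walk hW.apply_nonneg (fun i l h => hW.pos_of_adj i l (.inr h)) p⟩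
  have hap : IsAperiodic W := fun s d h =>
    Nat.dvd_one.1 (h 1 (by simpa using hW.pos_of_adj s s (.inl rfl)))
  exact hirr.isPrimitive hap hW.apply_nonneg

end IsMixingMatrix

section Averaging

variable {ι : Type*} [Fintype ι]

variable (ι) in
/-- The matrix all of whose entries are `1 / |ι|`: the orthogonal projection onto the constant
vectors, and the limit of the powers of a primitive doubly stochastic matrix. -/
def averaging : Matrix ι ι ℝ := Matrix.of fun _ _ => (Fintype.card ι : ℝ)⁻¹

variable [DecidableEq ι] {A : Matrix ι ι ℝ}

theorem mul_averaging (hA : A ∈ doublyStochastic ℝ ι) : A * averaging ι = averaging ι := by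
  ext s t
  simp [averaging, Matrix.mul_apply, ← Finset.sum_mul, sum_row_of_mem_doublyStochastic hA]

theorem averaging_mul (hA : A ∈ doublyStochastic ℝ ι) : averaging ι * A = averaging ι := by
  ext s t
  simp [averaging, Matrix.mul_apply, ← Finset.mul_sum, sum_col_of_mem_doublyStochastic hA]

theorem pow_mul_sub_averaging (hA : A ∈ doublyStochastic ℝ ι) (k : ℕ) :
    A ^ k * (A - averaging ι) = A ^ (k + 1) - averaging ι := by
  rw [mul_sub, mul_averaging (pow_mem hA k), pow_succ]

open Polynomial in
theorem charpoly_mul_charpoly_of_mul_eq_zero {R : Type*} [CommRing R] {A B : Matrix ι ι R}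
    (h : A * B = 0) : A.charpoly * B.charpoly = X ^ Fintype.card ι * (A + B).charpoly := by
  have hmul : A.charmatrix * B.charmatrix = (X : R[X]) • (A + B).charmatrix := by
    have hAB : A.map (C : R →+* R[X]) * B.map (C : R →+* R[X]) = 0 := by
      rw [← Matrix.map_mul, h, Matrix.map_zero _ (map_zero _)]
    simp only [Matrix.charmatrix, sub_mul, mul_sub, RingHom.mapMatrix_apply, hAB,
      ← Matrix.smul_one_eq_diagonal, Matrix.scalar_apply, Matrix.map_add _ (map_add _), smul_sub,
      smul_mul_assoc, mul_smul_comm, one_mul, mul_one, smul_add]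
    abel
  rw [Matrix.charpoly, Matrix.charpoly, ← Matrix.det_mul, hmul, Matrix.det_smul, Matrix.charpoly]

variable [Nonempty ι]

variable (ι) in
theorem averaging_mem_doublyStochastic : averaging ι ∈ doublyStochastic ℝ ι :=
  mem_doublyStochastic_iff_sum.2
    ⟨fun _ _ => by simp [averaging], fun _ => by simp [averaging], fun _ => by simp [averaging]⟩

theorem averaging_mul_sub_averaging (hA : A ∈ doublyStochastic ℝ ι) :
    averaging ι * (A - averaging ι) = 0 := by
  rw [mul_sub, averaging_mul hA, averaging_mul (averaging_mem_doublyStochastic ι), sub_self]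

theorem sub_averaging_mul_averaging (hA : A ∈ doublyStochastic ℝ ι) :
    (A - averaging ι) * averaging ι = 0 := by
  rw [sub_mul, mul_averaging hA, averaging_mul (averaging_mem_doublyStochastic ι), sub_self]

theorem sub_averaging_pow (hA : A ∈ doublyStochastic ℝ ι) (k : ℕ) :
    (A - averaging ι) ^ (k + 1) = A ^ (k + 1) - averaging ι := by
  induction k with
  | zero => simp
  | succ k ih =>
    rw [pow_succ, ih, sub_mul, averaging_mul_sub_averaging hA, pow_mul_sub_averaging hA, sub_zero]

open Polynomial in
theorem charpoly_averaging :
    (averaging ι).charpoly = X ^ (Fintype.card ι - 1) * (X - C 1) := by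
  have hvec : averaging ι = Matrix.vecMulVec (fun _ => (Fintype.card ι : ℝ)⁻¹) 1 := by
    ext; simp [averaging, Matrix.vecMulVec_apply]
  have hdot : (fun _ : ι => (Fintype.card ι : ℝ)⁻¹) ⬝ᵥ 1 = 1 := by simp [dotProduct]
  rw [hvec, Matrix.charpoly_vecMulVec, hdot, one_smul, mul_sub, map_one, mul_one, ← pow_succ,
    Nat.sub_add_cancel Fintype.card_pos]

open Polynomial in
theorem charpoly_sub_averaging_mul (hA : A ∈ doublyStochastic ℝ ι) :
    (A - averaging ι).charpoly * (X - C 1) = X * A.charpoly := by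
  have h := charpoly_mul_charpoly_of_mul_eq_zero (sub_averaging_mul_averaging hA)
  rw [sub_add_cancel, charpoly_averaging, ← Nat.sub_add_cancel (Fintype.card_pos (α := ι)),
    pow_succ] at h
  refine mul_left_cancel₀ (pow_ne_zero (Fintype.card ι - 1) X_ne_zero) ?_
  simpa [mul_assoc, mul_left_comm] using h

open Polynomial in
theorem roots_charpoly_sub_averaging (hA : A ∈ doublyStochastic ℝ ι) :
    ((A - averaging ι).map (algebraMap ℝ ℂ)).charpoly.roots =
      0 ::ₘ (A.map (algebraMap ℝ ℂ)).charpoly.roots.erase 1 := by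
  have h : ((A - averaging ι).map (algebraMap ℝ ℂ)).charpoly * (X - C 1) =
      X * (A.map (algebraMap ℝ ℂ)).charpoly := by
    simpa [← Matrix.charpoly_map, -Complex.coe_algebraMap] using
      congrArg (Polynomial.map (algebraMap ℝ ℂ)) (charpoly_sub_averaging_mul hA)
  have hroots := congrArg roots h
  rw [roots_mul (mul_ne_zero (Matrix.charpoly_monic _).ne_zero (X_sub_C_ne_zero 1)),
    roots_mul (mul_ne_zero X_ne_zero (Matrix.charpoly_monic _).ne_zero), roots_X_sub_C, roots_X]
    at hroots
  have hone : (1 : ℂ) ∈ (A.map (algebraMap ℝ ℂ)).charpoly.roots := by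
    have hmem := hroots ▸ Multiset.mem_add.2 (.inr (Multiset.mem_singleton_self (1 : ℂ)))
    simpa only [Multiset.mem_add, Multiset.mem_singleton, one_ne_zero, false_or] using hmem
  rw [← add_left_inj {1}, hroots, Multiset.singleton_add, Multiset.cons_add, add_comm _ {1},
    Multiset.singleton_add, Multiset.cons_erase hone]

end Averaging

section PowerBounds

theorem le_mul_pow_of_succ_le {c : ℕ → ℝ} {A ρ r : ℝ} (hc : 0 ≤ c 0) (hA : 0 ≤ A) (hρ : 0 ≤ ρ)
    (hr : ρ < r) (h : ∀ k, c (k + 1) ≤ ρ * c k + A * r ^ k) (k : ℕ) :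
    c k ≤ (c 0 + A / (r - ρ)) * r ^ k := by
  have hr0 : 0 ≤ r := hρ.trans hr.le
  have hcancel : A / (r - ρ) * (r - ρ) = A := div_mul_cancel₀ A (sub_pos.2 hr).ne'
  induction k with
  | zero => simpa using div_nonneg hA (sub_pos.2 hr).le
  | succ k ih =>
    calc c (k + 1) ≤ ρ * ((c 0 + A / (r - ρ)) * r ^ k) + A * r ^ k :=
          (h k).trans (by gcongr)
      _ = (c 0 + A / (r - ρ)) * r ^ (k + 1) - (r - ρ) * c 0 * r ^ k := by
          linear_combination (-r ^ k) * hcancel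
      _ ≤ (c 0 + A / (r - ρ)) * r ^ (k + 1) :=
          sub_le_self _ (mul_nonneg (mul_nonneg (sub_pos.2 hr).le hc) (pow_nonneg hr0 k))

theorem one_sub_div_mem_Icc {ρ : ℝ} (hρ : 0 ≤ ρ) (hρ1 : ρ ≤ 1) {d : ℕ} (hd : d ≠ 0) :
    1 - (1 - ρ) / (2 * d) ∈ Set.Icc (0 : ℝ) 1 := by
  have hd1 : (1 : ℝ) ≤ d := by exact_mod_cast Nat.one_le_iff_ne_zero.2 hd
  refine ⟨sub_nonneg.2 ((div_le_one (by positivity)).2 (by linarith)), sub_le_self _ ?_⟩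
  exact div_nonneg (sub_nonneg.2 hρ1) (by positivity)

theorem half_one_add_le_pow {ρ : ℝ} (hρ : 0 ≤ ρ) (hρ1 : ρ ≤ 1) {d : ℕ} (hd : d ≠ 0) :
    (1 + ρ) / 2 ≤ (1 - (1 - ρ) / (2 * d)) ^ d := by
  have h := (one_sub_div_mem_Icc hρ hρ1 hd).1
  calc (1 + ρ) / 2 = 1 + d * -((1 - ρ) / (2 * d)) := by field_simp; ring
    _ ≤ (1 + -((1 - ρ) / (2 * d))) ^ d := one_add_mul_le_pow (by linarith) d
    _ = _ := by rw [← sub_eq_add_neg]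

variable {𝕜 𝔸 : Type*} [NormedField 𝕜] [NormedRing 𝔸] [NormedAlgebra 𝕜 𝔸] {a q b : 𝔸}

theorem norm_pow_succ_mul_le (a b : 𝔸) (z : 𝕜) (k : ℕ) :
    ‖a ^ (k + 1) * b‖ ≤ ‖z‖ * ‖a ^ k * b‖ + ‖a ^ k * (a * b - z • b)‖ := by
  have hsplit : a ^ (k + 1) * b = z • (a ^ k * b) + a ^ k * (a * b - z • b) := by
    rw [mul_sub, mul_smul_comm, pow_succ, mul_assoc, add_sub_cancel]
  exact hsplit ▸ (norm_add_le _ _).trans (add_le_add_left (norm_smul_le _ _) _)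

open Polynomial in
theorem norm_pow_mul_le {R ρ r : ℝ} (hR : ‖a‖ ≤ R) (hρ : 0 ≤ ρ) (hr : ρ < r) {s : Multiset 𝕜}
    (hs : ∀ z ∈ s, ‖z‖ ≤ ρ) (hb : aeval a (s.map fun z => X - C z).prod * b = 0) (k : ℕ) :
    ‖a ^ k * b‖ ≤ (1 + (R + ρ) / (r - ρ)) ^ s.card * ‖b‖ * r ^ k := by
  have hR0 : 0 ≤ R := (norm_nonneg a).trans hR
  have hK : 0 ≤ (R + ρ) / (r - ρ) := div_nonneg (add_nonneg hR0 hρ) (sub_pos.2 hr).le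
  have hr0 : 0 ≤ r := hρ.trans hr.le
  induction s using Multiset.induction_on generalizing b k with
  | empty =>
    have hb0 : b = 0 := by simpa using hb
    simp [hb0]
  | cons z s ih =>
    have hz : ‖z‖ ≤ ρ := hs z (Multiset.mem_cons_self z s)
    set b' := a * b - z • b with hb'
    have hbz : aeval a (s.map fun z => X - C z).prod * b' = 0 := by
      have haz : aeval a (X - C z : 𝕜[X]) * b = b' := by
        simp [hb', sub_mul, Algebra.smul_def]
      rwa [Multiset.map_cons, Multiset.prod_cons, mul_comm, map_mul, mul_assoc, haz] at hb
    have hb'_le : ‖b'‖ ≤ (R + ρ) * ‖b‖ :=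
      calc ‖b'‖ ≤ ‖a‖ * ‖b‖ + ‖z‖ * ‖b‖ :=
            (norm_sub_le _ _).trans (add_le_add (norm_mul_le a b) (norm_smul_le z b))
        _ ≤ R * ‖b‖ + ρ * ‖b‖ := by gcongr
        _ = (R + ρ) * ‖b‖ := by ring
    set K := 1 + (R + ρ) / (r - ρ) with hKdef
    have hrec : ∀ k, ‖a ^ (k + 1) * b‖ ≤
        ρ * ‖a ^ k * b‖ + K ^ s.card * ((R + ρ) * ‖b‖) * r ^ k := fun k =>
      calc ‖a ^ (k + 1) * b‖ ≤ ‖z‖ * ‖a ^ k * b‖ + ‖a ^ k * b'‖ := norm_pow_succ_mul_le a b z k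
        _ ≤ ρ * ‖a ^ k * b‖ + K ^ s.card * ‖b'‖ * r ^ k := by
            gcongr
            exact ih (fun w hw => hs w (Multiset.mem_cons_of_mem hw)) hbz k
        _ ≤ _ := by gcongr
    refine (le_mul_pow_of_succ_le (c := fun k => ‖a ^ k * b‖) (norm_nonneg _) (by positivity)
      hρ hr hrec k).trans (mul_le_mul_of_nonneg_right ?_ (pow_nonneg hr0 k))
    have hK1 : ‖b‖ ≤ K ^ s.card * ‖b‖ :=
      le_mul_of_one_le_left (norm_nonneg b) (one_le_pow₀ (le_add_of_nonneg_right hK))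
    simp only [pow_zero, one_mul, Multiset.card_cons]
    calc ‖b‖ + K ^ s.card * ((R + ρ) * ‖b‖) / (r - ρ)
        ≤ K ^ s.card * ‖b‖ + K ^ s.card * ((R + ρ) * ‖b‖) / (r - ρ) := by gcongr
      _ = K ^ (s.card + 1) * ‖b‖ := by rw [hKdef]; ring

variable [NormOneClass 𝔸]

open Polynomial in
theorem norm_pow_le_of_forall_norm_pow_le {A ρ : ℝ} (hA : ∀ k, ‖a ^ k‖ ≤ A) (hρ : 0 ≤ ρ)
    (hρ1 : ρ < 1) {s : Multiset 𝕜} (hs0 : s ≠ 0) (hs : ∀ z ∈ s, ‖z‖ ≤ ρ)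
    (ha : aeval a (s.map fun z => X - C z).prod = 0) (k : ℕ) :
    ‖a ^ k‖ ≤ 2 * A * (1 + A) / (1 - ρ) * (1 - (1 - ρ) / (2 * s.card)) ^ k := by
  have hcard : s.card ≠ 0 := (Multiset.card_pos.2 hs0).ne'
  have hA1 : 1 ≤ A := by simpa using hA 0
  have hσ0 := (one_sub_div_mem_Icc hρ hρ1.le hcard).1
  set σ := 1 - (1 - ρ) / (2 * s.card)
  set K := 1 + (A + ρ) / ((1 - ρ) / 2) with hK
  have hpos : 0 < 1 - ρ := by linarith
  have hKle : K ≤ 2 * (1 + A) / (1 - ρ) :=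
    calc K = (1 + ρ + 2 * A) / (1 - ρ) := by rw [hK]; field_simp; ring
      _ ≤ 2 * (1 + A) / (1 - ρ) := by gcongr; linarith
  -- Comparing `K * σ ^ k` with `1` and using `hA` trades the power `K ^ s.card` for the factor `A`.
  have hpow : ‖a ^ k‖ ≤ (K * σ ^ k) ^ s.card := by
    have h := norm_pow_mul_le (a := a) (b := 1) (by simpa using hA 1) hρ
      (by linarith : ρ < (1 + ρ) / 2) hs (by rw [ha, zero_mul]) k
    rw [mul_one, norm_one, mul_one, show (1 + ρ) / 2 - ρ = (1 - ρ) / 2 by ring] at h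
    calc ‖a ^ k‖ ≤ K ^ s.card * ((1 + ρ) / 2) ^ k := h
      _ ≤ K ^ s.card * (σ ^ s.card) ^ k := by
          gcongr
          exact half_one_add_le_pow hρ hρ1.le hcard
      _ = _ := by rw [mul_pow, ← pow_mul, ← pow_mul, mul_comm k]
  have hAK : ‖a ^ k‖ ≤ A * (K * σ ^ k) := by
    have h0 : 0 ≤ K * σ ^ k := by positivity
    rcases le_total (K * σ ^ k) 1 with h1 | h1
    · exact (hpow.trans (pow_le_of_le_one h0 h1 hcard)).trans (le_mul_of_one_le_left h0 hA1)
    · exact (hA k).trans (le_mul_of_one_le_right (by linarith) h1)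
  calc ‖a ^ k‖ ≤ A * (K * σ ^ k) := hAK
    _ ≤ A * (2 * (1 + A) / (1 - ρ) * σ ^ k) := by gcongr
    _ = _ := by ring

theorem norm_lt_one_of_mem_spectrum [CompleteSpace 𝔸] {N : ℕ} (h : a ^ (N + 1) = q * a)
    (hq : ‖q‖ < 1) {z : 𝕜} (hz : z ∈ spectrum 𝕜 a) : ‖z‖ < 1 := by
  have hpow : ∀ k, a ^ (N * k + 1) = q ^ k * a := fun k => by
    induction k with
    | zero => simp
    | succ k ih =>
      rw [mul_add, mul_one, add_right_comm, pow_add, ih, mul_assoc, ← pow_succ', h, ← mul_assoc,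
        ← pow_succ]
  by_contra! hz1
  have hle : ∀ k, 1 ≤ ‖q‖ ^ k * ‖a‖ := fun k =>
    calc 1 ≤ ‖z ^ (N * k + 1)‖ := by rw [norm_pow]; exact one_le_pow₀ hz1
      _ ≤ ‖q ^ k * a‖ := hpow k ▸ spectrum.norm_le_norm_of_mem (spectrum.pow_mem_pow a _ hz)
      _ ≤ ‖q‖ ^ k * ‖a‖ :=
          (norm_mul_le _ _).trans (mul_le_mul_of_nonneg_right (norm_pow_le q k) (norm_nonneg a))
  have hlim : Tendsto (fun k => ‖q‖ ^ k * ‖a‖) atTop (𝓝 0) := by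
    simpa using (tendsto_pow_atTop_nhds_zero_of_lt_one (norm_nonneg q) hq).mul_const ‖a‖
  exact (ge_of_tendsto' hlim hle).not_gt one_pos

end PowerBounds

section SpectralGap

attribute [local instance] Matrix.linftyOpNormedRing Matrix.linftyOpNormedAlgebra
  Matrix.linfty_opNormOneClass

variable {ι : Type*} [Fintype ι] [DecidableEq ι]

theorem sum_abs_apply_le_norm (A : Matrix ι ι ℝ) (s : ι) : ∑ t, |A s t| ≤ ‖A‖ := by
  rw [Matrix.linfty_opNorm_def]
  simpa using NNReal.coe_le_coe.2
    (Finset.le_sup (f := fun s => ∑ t, ‖A s t‖₊) (Finset.mem_univ s))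

theorem norm_le_of_forall_sum_abs_apply_le {A : Matrix ι ι ℝ} {c : ℝ} (hc : 0 ≤ c)
    (h : ∀ s, ∑ t, |A s t| ≤ c) : ‖A‖ ≤ c := by
  lift c to NNReal using hc
  rw [Matrix.linfty_opNorm_def]
  exact NNReal.coe_le_coe.2 (Finset.sup_le fun s _ => NNReal.coe_le_coe.1 (by simpa using h s))

theorem norm_map_algebraMap (A : Matrix ι ι ℝ) : ‖A.map (algebraMap ℝ ℂ)‖ = ‖A‖ := by
  simp [Matrix.linfty_opNorm_def]

theorem norm_le_one_of_mem_doublyStochastic {A : Matrix ι ι ℝ} (hA : A ∈ doublyStochastic ℝ ι) :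
    ‖A‖ ≤ 1 :=
  norm_le_of_forall_sum_abs_apply_le zero_le_one fun s => by
    simp only [abs_of_nonneg (nonneg_of_mem_doublyStochastic hA),
      sum_row_of_mem_doublyStochastic hA, le_refl]

variable [Nonempty ι]

-- Doeblin's minorization: subtracting the smallest entry of `A` from all entries leaves a
-- nonnegative matrix with row sums below one.
theorem exists_norm_sub_smul_averaging_lt_one {A : Matrix ι ι ℝ} (hA : A ∈ doublyStochastic ℝ ι)
    (hpos : ∀ s t, 0 < A s t) : ∃ c : ℝ, ‖A - c • averaging ι‖ < 1 := by
  obtain ⟨⟨s₀, t₀⟩, hmin⟩ := Finite.exists_min fun p : ι × ι => A p.1 p.2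
  have hcard : (0 : ℝ) < Fintype.card ι := by exact_mod_cast Fintype.card_pos
  set c := Fintype.card ι * A s₀ t₀ with hc
  have hc0 : 0 < c := mul_pos hcard (hpos s₀ t₀)
  have hentry : ∀ s t, (A - c • averaging ι) s t = A s t - A s₀ t₀ := fun s t => by
    simp only [hc, averaging, Matrix.smul_of, Matrix.sub_apply, Matrix.of_apply, Pi.smul_apply,
      smul_eq_mul, sub_right_inj]
    field_simp
  have hrow : ∀ s, ∑ t, |(A - c • averaging ι) s t| = 1 - c := fun s => by
    calc ∑ t, |(A - c • averaging ι) s t| = ∑ t, (A s t - A s₀ t₀) :=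
          Finset.sum_congr rfl fun t _ => by
            rw [hentry, abs_of_nonneg (sub_nonneg.2 (hmin (s, t)))]
      _ = 1 - c := by
          rw [Finset.sum_sub_distrib, sum_row_of_mem_doublyStochastic hA]
          simp [hc]
  have h1c : 0 ≤ 1 - c := hrow s₀ ▸ Finset.sum_nonneg fun _ _ => abs_nonneg _
  exact ⟨c, (norm_le_of_forall_sum_abs_apply_le h1c fun s => (hrow s).le).trans_lt (by linarith)⟩

theorem norm_lt_one_of_mem_roots_charpoly_sub_averaging {A : Matrix ι ι ℝ}
    (hA : A ∈ doublyStochastic ℝ ι) (hprim : A.IsPrimitive) {z : ℂ}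
    (hz : z ∈ ((A - averaging ι).map (algebraMap ℝ ℂ)).charpoly.roots) : ‖z‖ < 1 := by
  obtain ⟨N, -, hN⟩ := hprim.exists_pos_pow
  obtain ⟨c, hc⟩ := exists_norm_sub_smul_averaging_lt_one (pow_mem hA N) hN
  have hpow : (A - averaging ι) ^ (N + 1) =
      (A ^ N - c • averaging ι) * (A - averaging ι) := by
    rw [sub_averaging_pow hA, sub_mul, smul_mul_assoc, averaging_mul_sub_averaging hA, smul_zero,
      sub_zero, pow_mul_sub_averaging hA]
  refine norm_lt_one_of_mem_spectrum (𝕜 := ℂ) (N := N) ?_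
    ((norm_map_algebraMap _).trans_lt hc) (Matrix.mem_spectrum_iff_isRoot_charpoly.2
      (Polynomial.isRoot_of_mem_roots hz))
  simpa only [map_pow, map_mul, RingHom.mapMatrix_apply] using
    congrArg (algebraMap ℝ ℂ).mapMatrix hpow

theorem norm_sub_averaging_pow_le {A : Matrix ι ι ℝ} (hA : A ∈ doublyStochastic ℝ ι) (k : ℕ) :
    ‖(A - averaging ι) ^ k‖ ≤ 2 := by
  cases k with
  | zero => simp
  | succ k =>
    rw [sub_averaging_pow hA]
    calc ‖A ^ (k + 1) - averaging ι‖ ≤ 1 + 1 :=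
          (norm_sub_le _ _).trans (add_le_add (norm_le_one_of_mem_doublyStochastic (pow_mem hA _))
            (norm_le_one_of_mem_doublyStochastic (averaging_mem_doublyStochastic ι)))
      _ = 2 := by norm_num

theorem secondModulus_nonneg {d : ℕ} (A : Matrix (Fin d) (Fin d) ℝ) : 0 ≤ secondModulus A :=
  NNReal.coe_nonneg _

theorem multisetSup_lt {α : Type*} [LinearOrder α] [OrderBot α] {s : Multiset α} {a : α}
    (ha : ⊥ < a) (h : ∀ b ∈ s, b < a) : s.sup < a := by
  induction s using Multiset.induction_on with
  | empty => simpa using ha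
  | cons b s ih =>
    rw [Multiset.sup_cons]
    exact max_lt (h b (Multiset.mem_cons_self b s))
      (ih fun c hc => h c (Multiset.mem_cons_of_mem hc))

theorem mixingRate_mem_Ico {d : ℕ} {A : Matrix (Fin d) (Fin d) ℝ}
    (hρ : secondModulus A < 1) : mixingRate A ∈ Set.Ico (0 : ℝ) 1 := by
  have hρ0 := secondModulus_nonneg A
  constructor <;> rw [mixingRate] <;> linarith

theorem one_div_one_sub_secondModulus_le {d : ℕ} {A : Matrix (Fin d) (Fin d) ℝ}
    (hρ : secondModulus A < 1) :
    1 / (1 - secondModulus A) ≤ 1 / Real.log (1 / mixingRate A) := by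
  have hρ0 := secondModulus_nonneg A
  have hpos : 0 < mixingRate A := by rw [mixingRate]; linarith
  refine one_div_le_one_div_of_le
    (Real.log_pos ((one_lt_div hpos).2 (mixingRate_mem_Ico hρ).2)) ?_
  calc Real.log (1 / mixingRate A) ≤ 1 / mixingRate A - 1 :=
        Real.log_le_sub_one_of_pos (one_div_pos.2 hpos)
    _ ≤ 1 - secondModulus A := by
        rw [div_sub_one hpos.ne', div_le_iff₀ hpos, mixingRate]
        nlinarith

variable {d : ℕ} [NeZero d] {A : Matrix (Fin d) (Fin d) ℝ}

theorem norm_le_secondModulus (hA : A ∈ doublyStochastic ℝ (Fin d)) {z : ℂ}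
    (hz : z ∈ ((A - averaging (Fin d)).map (algebraMap ℝ ℂ)).charpoly.roots) :
    ‖z‖ ≤ secondModulus A := by
  rw [roots_charpoly_sub_averaging hA, Multiset.mem_cons] at hz
  obtain rfl | hz := hz
  · simpa using secondModulus_nonneg A
  · exact_mod_cast Multiset.le_sup (Multiset.mem_map_of_mem (fun z : ℂ => ‖z‖₊) hz)

theorem secondModulus_lt_one (hA : A ∈ doublyStochastic ℝ (Fin d)) (hprim : A.IsPrimitive) :
    secondModulus A < 1 := by
  have hlt : ∀ r ∈ ((A.map (algebraMap ℝ ℂ)).charpoly.roots.erase 1).map fun z => ‖z‖₊, r < 1 := by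
    intro r hr
    obtain ⟨z, hz, rfl⟩ := Multiset.mem_map.1 hr
    exact norm_lt_one_of_mem_roots_charpoly_sub_averaging hA hprim
      (roots_charpoly_sub_averaging hA ▸ Multiset.mem_cons_of_mem hz)
  exact NNReal.coe_lt_one.2 (multisetSup_lt zero_lt_one hlt)

theorem norm_pow_sub_averaging_le (hA : A ∈ doublyStochastic ℝ (Fin d)) (hρ : secondModulus A < 1)
    (k : ℕ) : ‖A ^ k - averaging (Fin d)‖ ≤
      12 / (1 - secondModulus A) * (1 - (1 - secondModulus A) / (2 * d)) ^ k := by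
  have hρ0 := secondModulus_nonneg A
  cases k with
  | zero =>
    rw [pow_zero, pow_zero, mul_one]
    calc ‖1 - averaging (Fin d)‖ ≤ 1 + 1 := (norm_sub_le _ _).trans (add_le_add norm_one.le
          (norm_le_one_of_mem_doublyStochastic (averaging_mem_doublyStochastic _)))
      _ ≤ 12 / (1 - secondModulus A) := by rw [le_div_iff₀ (by linarith)]; linarith
  | succ k =>
    set D := (A - averaging (Fin d)).map (algebraMap ℝ ℂ)
    have hDpow : ∀ k, ‖D ^ k‖ = ‖(A - averaging (Fin d)) ^ k‖ := fun k => by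
      rw [← norm_map_algebraMap, Matrix.map_pow]
    have hcard : D.charpoly.roots.card = d := by
      rw [← (IsAlgClosed.splits D.charpoly).natDegree_eq_card_roots]; simp
    have hCayley : Polynomial.aeval D
        (D.charpoly.roots.map fun z => Polynomial.X - Polynomial.C z).prod = 0 := by
      rw [← (IsAlgClosed.splits _).eq_prod_roots_of_monic D.charpoly_monic,
        Matrix.aeval_self_charpoly]
    have h := norm_pow_le_of_forall_norm_pow_le (a := D) (A := 2)
      (fun k => hDpow k ▸ norm_sub_averaging_pow_le hA k) hρ0 hρ
      (Multiset.card_pos.1 (by rw [hcard]; exact NeZero.pos d))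
      (fun z => norm_le_secondModulus hA) hCayley (k + 1)
    rw [hDpow, sub_averaging_pow hA, hcard] at h
    convert h using 2
    norm_num

theorem hasSum_mixing_geometric (hρ : secondModulus A < 1) :
    HasSum (fun k => 12 / (1 - secondModulus A) * (1 - (1 - secondModulus A) / (2 * d)) ^ k)
      (24 * d / (1 - secondModulus A) ^ 2) := by
  have hd : (d : ℝ) ≠ 0 := NeZero.ne _
  have hδ : 0 < 1 - secondModulus A := sub_pos.2 hρ
  obtain ⟨hσ0, -⟩ := one_sub_div_mem_Icc (secondModulus_nonneg A) hρ.le (NeZero.ne d)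
  have hσ1 : 1 - (1 - secondModulus A) / (2 * d) < 1 := sub_lt_self _ (by positivity)
  have hsum : 12 / (1 - secondModulus A) * (1 - (1 - (1 - secondModulus A) / (2 * d)))⁻¹ =
      24 * d / (1 - secondModulus A) ^ 2 := by
    rw [sub_sub_cancel]
    field_simp
    norm_num
  exact hsum ▸ (hasSum_geometric_of_lt_one hσ0 hσ1).mul_left _

theorem summable_pow_sub_averaging (hA : A ∈ doublyStochastic ℝ (Fin d))
    (hρ : secondModulus A < 1) : Summable fun k => A ^ k - averaging (Fin d) :=
  (hasSum_mixing_geometric hρ).summable.of_norm_bounded (norm_pow_sub_averaging_le hA hρ)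

theorem sum_sum_abs_pow_sub_averaging_le (hA : A ∈ doublyStochastic ℝ (Fin d))
    (hρ : secondModulus A < 1) (s : Fin d) (N : ℕ) :
    ∑ k ∈ Finset.range N, ∑ t, |(A ^ k - averaging (Fin d)) s t| ≤
      24 * d / (1 - secondModulus A) ^ 2 :=
  calc _ ≤ ∑ k ∈ Finset.range N, ‖A ^ k - averaging (Fin d)‖ :=
        Finset.sum_le_sum fun _ _ => sum_abs_apply_le_norm _ s
    _ ≤ ∑ k ∈ Finset.range N,
          12 / (1 - secondModulus A) * (1 - (1 - secondModulus A) / (2 * d)) ^ k :=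
        Finset.sum_le_sum fun _ _ => norm_pow_sub_averaging_le hA hρ _
    _ ≤ _ := sum_le_hasSum _
        (fun _ _ => (norm_nonneg _).trans (norm_pow_sub_averaging_le hA hρ _))
        (hasSum_mixing_geometric hρ)

/-- The fundamental matrix `∑ₖ (Aᵏ - J)` of a doubly stochastic matrix, where `J` is the averaging
matrix: for a function `c` of the state, `poissonSolution A *ᵥ c` solves the Poisson equation
`u - A u = c - J c`. -/
def poissonSolution (A : Matrix (Fin d) (Fin d) ℝ) : Matrix (Fin d) (Fin d) ℝ :=
  ∑' k, (A ^ k - averaging (Fin d))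

theorem poissonSolution_sub_mul (hA : A ∈ doublyStochastic ℝ (Fin d)) (hρ : secondModulus A < 1) :
    poissonSolution A - A * poissonSolution A = 1 - averaging (Fin d) := by
  have hsum := summable_pow_sub_averaging hA hρ
  have hshift : A * poissonSolution A = ∑' k, (A ^ (k + 1) - averaging (Fin d)) := by
    rw [poissonSolution, ← hsum.tsum_mul_left]
    exact tsum_congr fun k => by rw [mul_sub, mul_averaging hA, pow_succ']
  rw [hshift, poissonSolution, hsum.tsum_eq_zero_add, pow_zero, add_sub_cancel_right]

theorem sum_abs_poissonSolution_le (hA : A ∈ doublyStochastic ℝ (Fin d))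
    (hρ : secondModulus A < 1) (s : Fin d) :
    ∑ t, |poissonSolution A s t| ≤ 24 * d / (1 - secondModulus A) ^ 2 :=
  (sum_abs_apply_le_norm _ s).trans
    (tsum_of_norm_bounded (hasSum_mixing_geometric hρ) (norm_pow_sub_averaging_le hA hρ))

end SpectralGap

section Averages

variable {E ι : Type*} [NormedAddCommGroup E] [NormedSpace ℝ E] [Fintype ι]

theorem norm_sum_smul_le {a : ι → ℝ} {u : ι → E} {K c : ℝ} (ha : ∑ t, |a t| ≤ K) (hc : 0 ≤ c)
    (hu : ∀ t, ‖u t‖ ≤ c) : ‖∑ t, a t • u t‖ ≤ K * c :=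
  calc ‖∑ t, a t • u t‖ ≤ ∑ t, |a t| * c :=
        norm_sum_le_of_le _ fun t _ => by rw [norm_smul, Real.norm_eq_abs]; gcongr; exact hu t
    _ ≤ K * c := by rw [← Finset.sum_mul]; gcongr

theorem norm_average_le {m : ℕ} {u : Fin m → E} {c : ℝ} (hc : 0 ≤ c) (hu : ∀ v, ‖u v‖ ≤ c) :
    ‖(1 / (m : ℝ)) • ∑ v, u v‖ ≤ c := by
  have hweights : ∑ _v : Fin m, |1 / (m : ℝ)| ≤ 1 := by
    simpa [abs_of_nonneg] using mul_inv_le_one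
  simpa [Finset.smul_sum] using norm_sum_smul_le hweights hc hu

end Averages

section Gradient

open scoped InnerProductSpace

variable {E : Type*} [NormedAddCommGroup E] [InnerProductSpace ℝ E] [CompleteSpace E]

theorem hasGradientAt_const_mul_sum {ι : Type*} [Fintype ι] (c : ℝ) {f : ι → E → ℝ} {f' : ι → E}
    {x : E} (h : ∀ i, HasGradientAt (f i) (f' i) x) :
    HasGradientAt (fun y => c * ∑ i, f i y) (c • ∑ i, f' i) x := by
  rw [hasGradientAt_iff_hasFDerivAt, map_smul, map_sum]
  exact (HasFDerivAt.fun_sum fun i _ => (h i).hasFDerivAt).const_mul c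

theorem hasDerivAt_comp_add_smul {F : E → ℝ} (hF : Differentiable ℝ F) (x d : E) (t : ℝ) :
    HasDerivAt (fun t : ℝ => F (x + t • d)) ⟪gradient F (x + t • d), d⟫_ℝ t := by
  have hline : HasDerivAt (fun t : ℝ => x + t • d) d t := by
    simpa using ((hasDerivAt_id t).smul_const d).const_add x
  rw [inner_gradient_left]
  exact (hF _).hasFDerivAt.comp_hasDerivAt t hline

theorem inner_gradient_sub_le_of_lipschitzWith {F : E → ℝ} {L : NNReal}
    (hL : LipschitzWith L (gradient F)) (x d : E) {t : ℝ} (ht : 0 ≤ t) :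
    ⟪gradient F (x + t • d), d⟫_ℝ - ⟪gradient F x, d⟫_ℝ ≤ L * t * ‖d‖ ^ 2 := by
  rw [← inner_sub_left]
  calc _ ≤ ‖gradient F (x + t • d) - gradient F x‖ * ‖d‖ := real_inner_le_norm _ _
    _ ≤ L * ‖x + t • d - x‖ * ‖d‖ := by gcongr; exact hL.norm_sub_le _ _
    _ = L * t * ‖d‖ ^ 2 := by
        rw [add_sub_cancel_left, norm_smul, Real.norm_of_nonneg ht]; ring

theorem le_add_inner_gradient_add {F : E → ℝ} {L : NNReal} (hF : Differentiable ℝ F)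
    (hL : LipschitzWith L (gradient F)) (x y : E) :
    F y ≤ F x + ⟪gradient F x, y - x⟫_ℝ + L / 2 * ‖y - x‖ ^ 2 := by
  set d := y - x with hd
  have hderiv : ∀ t, HasDerivAt
      (fun t : ℝ => F (x + t • d) - (t * ⟪gradient F x, d⟫_ℝ + L / 2 * ‖d‖ ^ 2 * t ^ 2))
      (⟪gradient F (x + t • d), d⟫_ℝ - (⟪gradient F x, d⟫_ℝ + L * t * ‖d‖ ^ 2)) t := fun t => by
    have hquad := ((hasDerivAt_id t).mul_const ⟪gradient F x, d⟫_ℝ).add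
      (((hasDerivAt_id t).pow 2).const_mul (L / 2 * ‖d‖ ^ 2))
    refine ((hasDerivAt_comp_add_smul hF x d t).sub hquad).congr_deriv ?_
    simp only [id_eq]
    ring
  have hanti := antitoneOn_of_deriv_nonpos (convex_Ici (0 : ℝ))
    (fun t _ => (hderiv t).continuousAt.continuousWithinAt)
    (fun t _ => (hderiv t).differentiableAt.differentiableWithinAt) fun t ht => by
      rw [interior_Ici] at ht
      rw [(hderiv t).deriv]
      linarith [inner_gradient_sub_le_of_lipschitzWith hL x d (le_of_lt ht)]
  have h := hanti Set.self_mem_Ici (zero_le_one (α := ℝ)) zero_le_one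
  simp only [one_smul, zero_smul, add_zero, one_mul, zero_mul, one_pow, mul_one, mul_zero, sub_zero,
    ne_eq, OfNat.ofNat_ne_zero, not_false_eq_true, zero_pow, hd, add_sub_cancel] at h
  linarith

end Gradient

section WeightedSums

variable {γ : ℕ → ℝ}

theorem sum_mul_convolution_le {a : ℕ → ℝ} {K : ℝ} (hγ : Antitone γ) (hγ0 : ∀ k, 0 ≤ γ k)
    (ha : ∀ r, 0 ≤ a r) (hK : ∀ N, ∑ r ∈ Finset.range N, a r ≤ K)
    (hγ2 : Summable fun k => γ k ^ 2) (N : ℕ) :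
    ∑ k ∈ Finset.range N, γ k * ∑ i ∈ Finset.range k, γ i * a (k - 1 - i) ≤
      K * ∑' k, γ k ^ 2 := by
  have hK0 : 0 ≤ K := by simpa using hK 0
  cases N with
  | zero => simpa using mul_nonneg hK0 (tsum_nonneg fun k => sq_nonneg (γ k))
  | succ N =>
    rw [Finset.sum_range_succ', Finset.sum_range_zero, mul_zero, add_zero]
    calc ∑ k ∈ Finset.range N, γ (k + 1) * ∑ i ∈ Finset.range (k + 1), γ i * a (k + 1 - 1 - i)
        ≤ ∑ k ∈ Finset.range N, ∑ i ∈ Finset.range (k + 1), γ i ^ 2 * a (k - i) := by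
          refine Finset.sum_le_sum fun k _ => ?_
          rw [Finset.mul_sum]
          refine Finset.sum_le_sum fun i hi => ?_
          rw [sq, ← mul_assoc, Nat.add_sub_cancel]
          gcongr
          · exact ha _
          · exact hγ0 i
          · exact hγ (Finset.mem_range.1 hi).le
      _ = ∑ i ∈ Finset.range N, γ i ^ 2 * ∑ r ∈ Finset.range (N - i), a r := by
          simp only [Finset.sum_range_diag_flip N fun i r => γ i ^ 2 * a r, Finset.mul_sum]
      _ ≤ ∑ i ∈ Finset.range N, γ i ^ 2 * K := by gcongr; exact hK _
      _ ≤ K * ∑' k, γ k ^ 2 := by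
          rw [← Finset.sum_mul, mul_comm]
          gcongr
          exact hγ2.sum_le_tsum _ fun k _ => sq_nonneg (γ k)

theorem sum_mul_sub_le {Φ : ℕ → ℝ} {c : ℝ} (hγ : Antitone γ) (hγ0 : ∀ k, 0 ≤ γ k)
    (hΦ : ∀ k, |Φ k| ≤ c) (N : ℕ) :
    ∑ k ∈ Finset.range N, γ k * (Φ (k + 1) - Φ k) ≤ 2 * c * γ 0 := by
  have habel : ∑ k ∈ Finset.range N, γ k * (Φ (k + 1) - Φ k) ≤
      γ N * Φ N - γ 0 * Φ 0 + c * (γ 0 - γ N) := by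
    induction N with
    | zero => simp
    | succ N ih =>
      rw [Finset.sum_range_succ]
      have hdec := mul_le_mul_of_nonneg_left (abs_le.1 (hΦ (N + 1))).2
        (sub_nonneg.2 (hγ N.le_succ))
      rw [Nat.succ_eq_add_one] at hdec
      linarith
  have hN := mul_le_mul_of_nonneg_left (abs_le.1 (hΦ N)).2 (hγ0 N)
  have h0 := mul_le_mul_of_nonneg_left (abs_le.1 (hΦ 0)).1 (hγ0 0)
  linarith

theorem sq_inf'_mul_sum_le {ι : Type*} {s : Finset ι} (hs : s.Nonempty) {w u : ι → ℝ}
    (hw : ∀ i ∈ s, 0 ≤ w i) (hu : ∀ i ∈ s, 0 ≤ u i) :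
    s.inf' hs u ^ 2 * ∑ i ∈ s, w i ≤ ∑ i ∈ s, w i * u i ^ 2 := by
  rw [Finset.mul_sum]
  refine Finset.sum_le_sum fun i hi => ?_
  rw [mul_comm]
  exact mul_le_mul_of_nonneg_left (pow_le_pow_left₀ (Finset.le_inf' _ _ hu)
    (Finset.inf'_le u hi) 2) (hw i hi)

end WeightedSums

section SlowVariation

theorem abs_pow_three_sub_pow_three_le {a b δ : ℝ} (ha : 0 ≤ a) (hb : 0 ≤ b)
    (h : |b - a| ≤ δ) : |b ^ 3 - a ^ 3| ≤ δ * (5 * a ^ 2 + 3 * δ ^ 2) := by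
  have hsq : (b - a) ^ 2 ≤ δ ^ 2 := sq_le_sq' (abs_le.1 h).1 (abs_le.1 h).2
  rw [show b ^ 3 - a ^ 3 = (b - a) * (b ^ 2 + b * a + a ^ 2) by ring, abs_mul,
    abs_of_nonneg (a := b ^ 2 + b * a + a ^ 2) (by positivity)]
  have hq : b ^ 2 + b * a + a ^ 2 ≤ 5 * a ^ 2 + 3 * δ ^ 2 := by nlinarith [sq_nonneg (b - 2 * a)]
  exact mul_le_mul h hq (by positivity) ((abs_nonneg _).trans h)

theorem eq_zero_of_tendsto_of_summable_mul {γ v : ℕ → ℝ} {l : ℝ} (hγ : ¬ Summable γ)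
    (hv : Tendsto v atTop (𝓝 l)) (hs : Summable fun k => γ k * v k) : l = 0 := by
  by_contra hl
  have hO : (fun k => γ k * v k * (v k)⁻¹) =O[atTop] fun k => γ k * v k := by
    simpa using (Asymptotics.isBigO_refl (fun k => γ k * v k) atTop).mul
      ((hv.inv₀ hl).isBigO_one ℝ)
  refine hγ ((summable_of_isBigO_nat hs hO).congr_atTop ?_)
  filter_upwards [hv.eventually_ne hl] with k hk
  rw [mul_inv_cancel_right₀ hk]

-- The cubes form a Cauchy sequence: their increments are of order `γ u² + γ³`.
theorem tendsto_zero_of_summable_mul_sq {γ u : ℕ → ℝ} {c : ℝ} (hγ : ¬ Summable γ)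
    (hγ3 : Summable fun k => γ k ^ 3) (hu : ∀ k, 0 ≤ u k) (hc : ∀ k, |u (k + 1) - u k| ≤ c * γ k)
    (hs : Summable fun k => γ k * u k ^ 2) : Tendsto u atTop (𝓝 0) := by
  have hcube : CauchySeq fun k => u k ^ 3 := by
    refine cauchySeq_of_dist_le_of_summable _ (fun k => ?_)
      ((hs.mul_left (5 * c)).add (hγ3.mul_left (3 * c ^ 3)))
    rw [dist_comm, Real.dist_eq]
    exact (abs_pow_three_sub_pow_three_le (hu k) (hu (k + 1)) (hc k)).trans_eq (by ring)
  obtain ⟨l, hl⟩ := cauchySeq_tendsto_of_complete hcube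
  have hroot : Tendsto u atTop (𝓝 (l ^ (3⁻¹ : ℝ))) :=
    (hl.rpow_const (Or.inr (by norm_num))).congr fun k => by
      exact_mod_cast Real.pow_rpow_inv_natCast (hu k) three_ne_zero
  have hzero := eq_zero_of_tendsto_of_summable_mul hγ (hroot.pow 2) hs
  rwa [pow_eq_zero_iff two_ne_zero |>.1 hzero] at hroot

end SlowVariation

section Stepsize

variable {θ : ℝ}

theorem stepsize_nonneg (θ : ℝ) (k : ℕ) : 0 ≤ stepsize θ k := by
  rw [stepsize]
  positivity

theorem stepsize_antitone (hθ : 0 ≤ θ) : Antitone (stepsize θ) := fun k l h => by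
  rw [stepsize, stepsize]
  gcongr

theorem stepsize_zero (θ : ℝ) : stepsize θ 0 = 1 := by simp [stepsize]

theorem summable_stepsize_pow_iff {p : ℕ} :
    (Summable fun k => stepsize θ k ^ p) ↔ 1 < θ * p := by
  have hpow : ∀ k, stepsize θ k ^ p = 1 / ((k + 1 : ℕ) : ℝ) ^ (θ * p) := fun k => by
    rw [stepsize, div_pow, one_pow, ← Real.rpow_mul_natCast (by positivity), Nat.cast_succ]
  simp only [hpow]
  rw [summable_nat_add_iff (f := fun k : ℕ => 1 / (k : ℝ) ^ (θ * p)) 1,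
    Real.summable_one_div_nat_rpow]

theorem rpow_le_sum_stepsize (hθ : 0 ≤ θ) (hθ' : θ ≤ 1) {k : ℕ} (hk : 1 ≤ k) :
    (k : ℝ) ^ (1 - θ) / 2 ≤ ∑ i ∈ Finset.Icc 1 k, stepsize θ i := by
  have hk' : (1 : ℝ) ≤ k := by exact_mod_cast hk
  have hlast : 1 / (2 * (k : ℝ) ^ θ) ≤ stepsize θ k := by
    rw [stepsize]
    gcongr
    calc ((k : ℝ) + 1) ^ θ ≤ (2 * k) ^ θ := by gcongr; linarith
      _ = 2 ^ θ * (k : ℝ) ^ θ := Real.mul_rpow two_pos.le (by positivity)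
      _ ≤ 2 * (k : ℝ) ^ θ := by gcongr; exact Real.rpow_le_self_of_one_le one_le_two hθ'
  calc (k : ℝ) ^ (1 - θ) / 2 = ∑ _i ∈ Finset.Icc 1 k, 1 / (2 * (k : ℝ) ^ θ) := by
        rw [Finset.sum_const, Nat.card_Icc, Nat.add_sub_cancel, nsmul_eq_mul,
          Real.rpow_sub (by positivity), Real.rpow_one]
        field_simp
    _ ≤ _ := Finset.sum_le_sum fun i hi =>
        hlast.trans (stepsize_antitone hθ (Finset.mem_Icc.1 hi).2)

theorem inf'_le_of_sum_stepsize_mul_sq_le (hθ : 0 ≤ θ) (hθ' : θ ≤ 1) {u : ℕ → ℝ}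
    (hu : ∀ k, 0 ≤ u k) {R : ℝ} (hR : ∀ N, ∑ k ∈ Finset.range N, stepsize θ k * u k ^ 2 ≤ R)
    {k : ℕ} (hk : 1 ≤ k) :
    (Finset.Icc 1 k).inf' (Finset.nonempty_Icc.2 hk) u ≤
      √(2 * R) / (k : ℝ) ^ ((1 - θ) / 2) := by
  set r := (Finset.Icc 1 k).inf' (Finset.nonempty_Icc.2 hk) u
  have hk' : (0 : ℝ) < k := by exact_mod_cast hk
  have hweighted : r ^ 2 * ((k : ℝ) ^ (1 - θ) / 2) ≤ R :=
    calc _ ≤ r ^ 2 * ∑ i ∈ Finset.Icc 1 k, stepsize θ i := by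
          gcongr
          exact rpow_le_sum_stepsize hθ hθ' hk
      _ ≤ ∑ i ∈ Finset.Icc 1 k, stepsize θ i * u i ^ 2 :=
          sq_inf'_mul_sum_le _ (fun i _ => stepsize_nonneg θ i) fun i _ => hu i
      _ ≤ ∑ i ∈ Finset.range (k + 1), stepsize θ i * u i ^ 2 :=
          Finset.sum_le_sum_of_subset_of_nonneg (fun _ hi =>
            Finset.mem_range.2 (Nat.lt_succ_of_le (Finset.mem_Icc.1 hi).2))
            fun i _ _ => mul_nonneg (stepsize_nonneg θ i) (sq_nonneg _)
      _ ≤ R := hR _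
  have hsq : ((k : ℝ) ^ ((1 - θ) / 2)) ^ 2 = (k : ℝ) ^ (1 - θ) := by
    rw [← Real.rpow_mul_natCast hk'.le]
    norm_num
  rw [le_div_iff₀ (by positivity)]
  refine Real.le_sqrt_of_sq_le ?_
  rw [mul_pow, hsq]
  linarith

end Stepsize

section Consensus

variable {ι E : Type*} [Fintype ι] [AddCommGroup E] [Module ℝ E]

theorem sum_smul_sum_smul (A A' : Matrix ι ι ℝ) (u : ι → E) (v : ι) :
    ∑ l, A v l • ∑ p, A' l p • u p = ∑ p, (A * A') v p • u p := by
  simp only [Finset.smul_sum, smul_smul, Matrix.mul_apply, Finset.sum_smul]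
  exact Finset.sum_comm

variable [DecidableEq ι] {W : Matrix ι ι ℝ} {x g : ℕ → ι → E}

theorem sum_one_sub_averaging_smul (u : ι → E) (v : ι) :
    ∑ p, (1 - averaging ι) v p • u p = u v - (1 / (Fintype.card ι : ℝ)) • ∑ p, u p := by
  simp [averaging, Matrix.one_apply, sub_smul, Finset.smul_sum]

theorem average_succ (hW : W ∈ doublyStochastic ℝ ι)
    (hx : ∀ k v, x (k + 1) v = ∑ l, W v l • x k l - g k v) (k : ℕ) (c : ℝ) :
    c • ∑ v, x (k + 1) v = c • ∑ v, x k v - c • ∑ v, g k v := by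
  simp only [hx, Finset.sum_sub_distrib, smul_sub]
  rw [Finset.sum_comm]
  simp only [← Finset.sum_smul, sum_col_of_mem_doublyStochastic hW, one_smul]

theorem sub_average_eq_neg_sum [Nonempty ι] (hW : W ∈ doublyStochastic ℝ ι)
    (hx : ∀ k v, x (k + 1) v = ∑ l, W v l • x k l - g k v) {x₀ : E} (h0 : ∀ v, x 0 v = x₀)
    (k : ℕ) (v : ι) :
    x k v - (1 / (Fintype.card ι : ℝ)) • ∑ l, x k l =
      -∑ i ∈ Finset.range k, ∑ l, (W ^ (k - 1 - i) - averaging ι) v l • g i l := by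
  induction k generalizing v with
  | zero => simp [h0, ← Nat.cast_smul_eq_nsmul ℝ, smul_smul]
  | succ k ih =>
    set y := (1 / (Fintype.card ι : ℝ)) • ∑ l, x k l
    have hmix : ∑ l, W v l • (x k l - y) =
        -∑ i ∈ Finset.range k, ∑ l, (W ^ (k - i) - averaging ι) v l • g i l := by
      simp only [ih, smul_neg, Finset.sum_neg_distrib, Finset.smul_sum (s := Finset.range k)]
      rw [Finset.sum_comm]
      refine congrArg Neg.neg (Finset.sum_congr rfl fun i hi => ?_)
      rw [sum_smul_sum_smul, mul_sub, mul_averaging hW, ← pow_succ',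
        show k - 1 - i + 1 = k - i by have := Finset.mem_range.1 hi; omega]
    calc _ = ∑ l, W v l • (x k l - y) - (g k v - (1 / (Fintype.card ι : ℝ)) • ∑ l, g k l) := by
          rw [average_succ hW hx, hx]
          simp only [smul_sub, Finset.sum_sub_distrib, ← Finset.sum_smul,
            sum_row_of_mem_doublyStochastic hW, one_smul]
          abel
      _ = _ := by
          rw [hmix, Finset.sum_range_succ, Nat.add_sub_cancel, Nat.sub_self, pow_zero,
            sum_one_sub_averaging_smul]
          abel

end Consensus

section ConsensusBound

variable {m : ℕ} {W : Matrix (Fin m) (Fin m) ℝ} {γ : ℕ → ℝ}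

/-- The bound of the distance of node `v` from the node average at step `k` that results from
gradients of norm at most one: the gradients of step `i` have since been mixed by `W` a further
`k - 1 - i` times. -/
def consensusBound (W : Matrix (Fin m) (Fin m) ℝ) (γ : ℕ → ℝ) (v : Fin m) (k : ℕ) : ℝ :=
  ∑ i ∈ Finset.range k, γ i * ∑ l, |(W ^ (k - 1 - i) - averaging (Fin m)) v l|

theorem sum_mul_consensusBound_le [NeZero m] (hW : W ∈ doublyStochastic ℝ (Fin m))
    (hρ : secondModulus W < 1) (hγ : Antitone γ) (hγ0 : ∀ k, 0 ≤ γ k)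
    (hγ2 : Summable fun k => γ k ^ 2) (v : Fin m) (N : ℕ) :
    ∑ k ∈ Finset.range N, γ k * consensusBound W γ v k ≤
      24 * m / (1 - secondModulus W) ^ 2 * ∑' k, γ k ^ 2 :=
  sum_mul_convolution_le hγ hγ0 (fun _ => Finset.sum_nonneg fun _ _ => abs_nonneg _)
    (fun N => sum_sum_abs_pow_sub_averaging_le hW hρ v N) hγ2 N

theorem norm_sub_average_le {E : Type*} [NormedAddCommGroup E] [NormedSpace ℝ E] [NeZero m]
    (hW : W ∈ doublyStochastic ℝ (Fin m)) (hγ : ∀ k, 0 ≤ γ k) {x g : ℕ → Fin m → E} {B : ℝ}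
    (hB : 0 ≤ B) (hx : ∀ k v, x (k + 1) v = ∑ l, W v l • x k l - γ k • g k v)
    (hg : ∀ k v, ‖g k v‖ ≤ B) {x₀ : E} (h0 : ∀ v, x 0 v = x₀) (k : ℕ) (v : Fin m) :
    ‖x k v - (1 / (m : ℝ)) • ∑ l, x k l‖ ≤ B * consensusBound W γ v k := by
  have heq := sub_average_eq_neg_sum hW hx h0 k v
  rw [Fintype.card_fin] at heq
  rw [heq, norm_neg, consensusBound, mul_comm, Finset.sum_mul]
  refine norm_sum_le_of_le _ fun i _ => ?_
  simp only [smul_comm _ (γ i), ← Finset.smul_sum]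
  rw [norm_smul, Real.norm_of_nonneg (hγ i), mul_assoc]
  exact mul_le_mul_of_nonneg_left (norm_sum_smul_le le_rfl hB (hg i)) (hγ i)

end ConsensusBound

section MeanIterate

variable {m M n : ℕ} {W : Matrix (Fin m) (Fin m) ℝ} {γ : ℕ → ℝ}
  {f : Fin m → Fin M → Param n → ℝ} {x₀ : Param n} {a : ℕ → Fin m → Fin M}

/-- The average over the nodes of the iterates along the sample trajectories `a`. -/
def meanIterate (W : Matrix (Fin m) (Fin m) ℝ) (γ : ℕ → ℝ) (f : Fin m → Fin M → Param n → ℝ)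
    (x₀ : Param n) (a : ℕ → Fin m → Fin M) (k : ℕ) : Param n :=
  nodeAverage (iterate W γ f x₀ a k)

/-- The gradient that node `v` samples at step `k` along the sample trajectories `a`. -/
def sampledGradient (W : Matrix (Fin m) (Fin m) ℝ) (γ : ℕ → ℝ)
    (f : Fin m → Fin M → Param n → ℝ) (x₀ : Param n) (a : ℕ → Fin m → Fin M) (k : ℕ)
    (v : Fin m) : Param n :=
  gradient (f v (a k v)) (iterate W γ f x₀ a k v)

theorem meanIterate_zero [NeZero m] : meanIterate W γ f x₀ a 0 = x₀ := by
  simp [meanIterate, nodeAverage, iterate, ← Nat.cast_smul_eq_nsmul ℝ, smul_smul]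

theorem meanIterate_succ (hW : W ∈ doublyStochastic ℝ (Fin m)) (k : ℕ) :
    meanIterate W γ f x₀ a (k + 1) = meanIterate W γ f x₀ a k -
      γ k • ((1 / (m : ℝ)) • ∑ v, sampledGradient W γ f x₀ a k v) := by
  rw [smul_comm, Finset.smul_sum]
  exact average_succ (x := iterate W γ f x₀ a)
    (g := fun k v => γ k • sampledGradient W γ f x₀ a k v) hW (fun _ _ => rfl) k (1 / (m : ℝ))

theorem iterate_congr {a' : ℕ → Fin m → Fin M} {k : ℕ} (h : ∀ i < k, a i = a' i) :
    iterate W γ f x₀ a k = iterate W γ f x₀ a' k := by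
  induction k with
  | zero => rfl
  | succ k ih =>
    ext1 v
    simp only [iterate, ih fun i hi => h i (by omega), h k (by omega)]

end MeanIterate

section Objective

open scoped InnerProductSpace

variable {m M n : ℕ} {f : Fin m → Fin M → Param n → ℝ} {B L : NNReal}

/-- The regularity of the component functions: differentiable, with gradients that are bounded by
`B` and `L`-Lipschitz. -/
structure IsRegular (f : Fin m → Fin M → Param n → ℝ) (B L : NNReal) : Prop where
  diff : ∀ v s, Differentiable ℝ (f v s)
  bound : ∀ v s x, ‖gradient (f v s) x‖ ≤ B
  lip : ∀ v s, LipschitzWith L (gradient (f v s))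

namespace IsRegular

theorem hasGradientAt_localLoss (hf : IsRegular f B L) (v : Fin m) (x : Param n) :
    HasGradientAt (localLoss f v) ((1 / (M : ℝ)) • ∑ s, gradient (f v s) x) x :=
  hasGradientAt_const_mul_sum _ fun s => (hf.diff v s x).hasGradientAt

theorem gradient_localLoss (hf : IsRegular f B L) (v : Fin m) (x : Param n) :
    gradient (localLoss f v) x = (1 / (M : ℝ)) • ∑ s, gradient (f v s) x :=
  (hf.hasGradientAt_localLoss v x).gradient

theorem hasGradientAt_objective (hf : IsRegular f B L) (x : Param n) :
    HasGradientAt (objective f) ((1 / (m : ℝ)) • ∑ v, gradient (localLoss f v) x) x :=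
  hasGradientAt_const_mul_sum _ fun v =>
    (hf.hasGradientAt_localLoss v x).differentiableAt.hasGradientAt

theorem gradient_objective (hf : IsRegular f B L) (x : Param n) :
    gradient (objective f) x = (1 / (m : ℝ)) • ∑ v, gradient (localLoss f v) x :=
  (hf.hasGradientAt_objective x).gradient

theorem differentiable_objective (hf : IsRegular f B L) : Differentiable ℝ (objective f) :=
  fun x => (hf.hasGradientAt_objective x).differentiableAt

theorem norm_gradient_objective_le (hf : IsRegular f B L) (x : Param n) :
    ‖gradient (objective f) x‖ ≤ B := by
  rw [hf.gradient_objective]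
  refine norm_average_le B.coe_nonneg fun v => ?_
  rw [hf.gradient_localLoss]
  exact norm_average_le B.coe_nonneg fun s => hf.bound v s x

theorem lipschitzWith_gradient_objective (hf : IsRegular f B L) :
    LipschitzWith L (gradient (objective f)) := by
  refine LipschitzWith.of_dist_le_mul fun x y => ?_
  rw [dist_eq_norm, hf.gradient_objective, hf.gradient_objective, ← smul_sub,
    ← Finset.sum_sub_distrib]
  refine norm_average_le (by positivity) fun v => ?_
  rw [hf.gradient_localLoss, hf.gradient_localLoss, ← smul_sub, ← Finset.sum_sub_distrib]
  exact norm_average_le (by positivity) fun s =>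
    (hf.lip v s).norm_sub_le_of_le (dist_eq_norm x y).ge

theorem norm_gradient_objective_sq (hf : IsRegular f B L) (x : Param n) :
    ‖gradient (objective f) x‖ ^ 2 =
      (1 / (m : ℝ)) * ∑ v, ⟪gradient (objective f) x, gradient (localLoss f v) x⟫_ℝ := by
  rw [← real_inner_self_eq_norm_sq, ← inner_sum, ← real_inner_smul_right, ← hf.gradient_objective]

end IsRegular

/-- The inner product of the gradient of the objective with the combination of the component
gradients of node `v` given by row `s` of `G`. For `G` a solution of the Poisson equation
`G - H * G = 1 - averaging` of the chain, it turns the bias of the sampled gradients into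
increments along the chain. -/
def corrector (f : Fin m → Fin M → Param n → ℝ) (G : Matrix (Fin M) (Fin M) ℝ) (v : Fin m)
    (s : Fin M) (x : Param n) : ℝ :=
  ⟪gradient (objective f) x, ∑ t, G s t • gradient (f v t) x⟫_ℝ

variable {G : Matrix (Fin M) (Fin M) ℝ} {K : ℝ}

namespace IsRegular

theorem abs_corrector_le (hf : IsRegular f B L) (hG : ∀ s, ∑ t, |G s t| ≤ K) (v : Fin m)
    (s : Fin M) (x : Param n) : |corrector f G v s x| ≤ B ^ 2 * K :=
  calc |corrector f G v s x| ≤ B * (K * B) :=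
        (abs_real_inner_le_norm _ _).trans (mul_le_mul (hf.norm_gradient_objective_le x)
          (norm_sum_smul_le (hG s) B.coe_nonneg fun t => hf.bound v t x) (norm_nonneg _)
          B.coe_nonneg)
    _ = B ^ 2 * K := by ring

theorem corrector_sub_le (hf : IsRegular f B L) (hG : ∀ s, ∑ t, |G s t| ≤ K) (v : Fin m)
    (s : Fin M) (x y : Param n) :
    corrector f G v s x - corrector f G v s y ≤ 2 * L * B * K * ‖x - y‖ := by
  have hsplit : corrector f G v s x - corrector f G v s y =
      ⟪gradient (objective f) x - gradient (objective f) y, ∑ t, G s t • gradient (f v t) x⟫_ℝ +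
      ⟪gradient (objective f) y, ∑ t, G s t • (gradient (f v t) x - gradient (f v t) y)⟫_ℝ := by
    simp only [corrector, smul_sub, Finset.sum_sub_distrib, inner_sub_left, inner_sub_right]
    ring
  have hobjective := (real_inner_le_norm _ _).trans (mul_le_mul
    (hf.lipschitzWith_gradient_objective.norm_sub_le x y)
    (norm_sum_smul_le (hG s) B.coe_nonneg fun t => hf.bound v t x) (norm_nonneg _) (by positivity))
  have hcomponents := (real_inner_le_norm _ _).trans (mul_le_mul (hf.norm_gradient_objective_le y)
    (norm_sum_smul_le (hG s) (by positivity) fun t => (hf.lip v t).norm_sub_le x y)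
    (norm_nonneg _) B.coe_nonneg)
  rw [hsplit]
  linarith

theorem sum_mul_corrector_sub_corrector (hf : IsRegular f B L) {H : Matrix (Fin M) (Fin M) ℝ}
    (hGH : G - H * G = 1 - averaging (Fin M)) (v : Fin m) (s : Fin M) (x : Param n) :
    ∑ t, H s t * corrector f G v t x - corrector f G v s x =
      ⟪gradient (objective f) x, gradient (localLoss f v) x - gradient (f v s) x⟫_ℝ := by
  simp only [corrector, ← real_inner_smul_right, ← inner_sum, ← inner_sub_right]
  congr 1
  rw [sum_smul_sum_smul, ← neg_sub, ← Finset.sum_sub_distrib]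
  simp only [← sub_smul, ← Matrix.sub_apply, hGH]
  rw [sum_one_sub_averaging_smul, Fintype.card_fin, ← hf.gradient_localLoss, neg_sub]

end IsRegular

end Objective

section Trajectory

open scoped InnerProductSpace

variable {m M n : ℕ} {W : Matrix (Fin m) (Fin m) ℝ} {γ : ℕ → ℝ}
  {f : Fin m → Fin M → Param n → ℝ} {B L : NNReal} {x₀ : Param n} {a : ℕ → Fin m → Fin M}
  {G H : Matrix (Fin M) (Fin M) ℝ} {K : ℝ}

/-- The one-step prediction error of the corrector along the chain of node `v`, at the frozen point
`meanIterate … k`; it has mean zero given the history up to time `k`. -/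
def samplingNoise (W : Matrix (Fin m) (Fin m) ℝ) (γ : ℕ → ℝ) (f : Fin m → Fin M → Param n → ℝ)
    (x₀ : Param n) (G H : Matrix (Fin M) (Fin M) ℝ) (a : ℕ → Fin m → Fin M) (k : ℕ)
    (v : Fin m) : ℝ :=
  ∑ t, H (a k v) t * corrector f G v t (meanIterate W γ f x₀ a k) -
    corrector f G v (a (k + 1) v) (meanIterate W γ f x₀ a k)

namespace IsRegular

theorem norm_meanIterate_succ_sub_le (hf : IsRegular f B L) (hγ : ∀ k, 0 ≤ γ k)
    (hW : W ∈ doublyStochastic ℝ (Fin m)) (k : ℕ) :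
    ‖meanIterate W γ f x₀ a (k + 1) - meanIterate W γ f x₀ a k‖ ≤ B * γ k := by
  rw [meanIterate_succ hW, sub_sub_cancel_left, norm_neg, norm_smul, Real.norm_of_nonneg (hγ k),
    mul_comm]
  gcongr
  · exact hγ k
  · exact norm_average_le B.coe_nonneg fun v => hf.bound v _ _

theorem norm_iterate_sub_meanIterate_le [NeZero m] (hf : IsRegular f B L) (hγ : ∀ k, 0 ≤ γ k)
    (hW : W ∈ doublyStochastic ℝ (Fin m)) (k : ℕ) (v : Fin m) :
    ‖iterate W γ f x₀ a k v - meanIterate W γ f x₀ a k‖ ≤ B * consensusBound W γ v k :=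
  norm_sub_average_le (x := iterate W γ f x₀ a) (g := sampledGradient W γ f x₀ a) hW hγ
    B.coe_nonneg (fun _ _ => rfl) (fun _ v => hf.bound v _ _) (fun _ => rfl) k v

theorem stepsize_mul_norm_sq_le (hf : IsRegular f B L) (hγ : ∀ k, 0 ≤ γ k)
    (hW : W ∈ doublyStochastic ℝ (Fin m)) (k : ℕ) :
    γ k * ‖gradient (objective f) (meanIterate W γ f x₀ a k)‖ ^ 2 ≤
      objective f (meanIterate W γ f x₀ a k) - objective f (meanIterate W γ f x₀ a (k + 1)) +
      L * B ^ 2 / 2 * γ k ^ 2 +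
      (1 / (m : ℝ)) * ∑ v, γ k * ⟪gradient (objective f) (meanIterate W γ f x₀ a k),
        gradient (localLoss f v) (meanIterate W γ f x₀ a k) -
          sampledGradient W γ f x₀ a k v⟫_ℝ := by
  have hdescent := le_add_inner_gradient_add hf.differentiable_objective
    hf.lipschitzWith_gradient_objective (meanIterate W γ f x₀ a k)
    (meanIterate W γ f x₀ a (k + 1))
  have hstep : ‖meanIterate W γ f x₀ a (k + 1) - meanIterate W γ f x₀ a k‖ ^ 2 ≤ (B * γ k) ^ 2 := by
    gcongr
    exact hf.norm_meanIterate_succ_sub_le hγ hW k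
  have hquad := mul_le_mul_of_nonneg_left hstep (by positivity : (0 : ℝ) ≤ L / 2)
  have hlinear : ⟪gradient (objective f) (meanIterate W γ f x₀ a k),
      meanIterate W γ f x₀ a (k + 1) - meanIterate W γ f x₀ a k⟫_ℝ =
      -(γ k * ((1 / (m : ℝ)) * ∑ v, ⟪gradient (objective f) (meanIterate W γ f x₀ a k),
        sampledGradient W γ f x₀ a k v⟫_ℝ)) := by
    rw [meanIterate_succ hW, sub_sub_cancel_left, inner_neg_right, real_inner_smul_right,
      real_inner_smul_right, inner_sum]
  rw [hlinear] at hdescent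
  simp only [inner_sub_right, mul_sub, Finset.sum_sub_distrib, ← Finset.mul_sum]
  rw [hf.norm_gradient_objective_sq]
  linarith

theorem inner_gradient_sub_sampledGradient_le [NeZero m] (hf : IsRegular f B L)
    (hγ : ∀ k, 0 ≤ γ k) (hW : W ∈ doublyStochastic ℝ (Fin m))
    (hGH : G - H * G = 1 - averaging (Fin M)) (hG : ∀ s, ∑ t, |G s t| ≤ K) (k : ℕ) (v : Fin m) :
    ⟪gradient (objective f) (meanIterate W γ f x₀ a k),
        gradient (localLoss f v) (meanIterate W γ f x₀ a k) - sampledGradient W γ f x₀ a k v⟫_ℝ ≤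
      samplingNoise W γ f x₀ G H a k v +
      (corrector f G v (a (k + 1) v) (meanIterate W γ f x₀ a (k + 1)) -
        corrector f G v (a k v) (meanIterate W γ f x₀ a k)) +
      2 * L * B ^ 2 * K * γ k + B ^ 2 * L * consensusBound W γ v k := by
  set y := meanIterate W γ f x₀ a k
  have hpoisson := hf.sum_mul_corrector_sub_corrector hGH v (a k v) y
  have hmove : corrector f G v (a (k + 1) v) y -
      corrector f G v (a (k + 1) v) (meanIterate W γ f x₀ a (k + 1)) ≤
      2 * L * B * K * (B * γ k) := by
    refine (hf.corrector_sub_le hG v _ _ _).trans ?_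
    have hK : 0 ≤ K := (Finset.sum_nonneg fun _ _ => abs_nonneg _).trans (hG (a k v))
    rw [norm_sub_rev]
    gcongr
    exact hf.norm_meanIterate_succ_sub_le hγ hW k
  have hconsensus : ⟪gradient (objective f) y,
      gradient (f v (a k v)) y - sampledGradient W γ f x₀ a k v⟫_ℝ ≤
      B * (L * (B * consensusBound W γ v k)) := by
    refine (real_inner_le_norm _ _).trans ?_
    gcongr
    · exact hf.norm_gradient_objective_le y
    · refine (hf.lip v (a k v)).norm_sub_le_of_le ?_
      rw [norm_sub_rev]
      exact hf.norm_iterate_sub_meanIterate_le hγ hW k v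
  rw [inner_sub_right] at hpoisson hconsensus ⊢
  rw [samplingNoise]
  linarith

theorem sum_mul_inner_le [NeZero m] (hf : IsRegular f B L) (hγ : Antitone γ)
    (hγ0 : ∀ k, 0 ≤ γ k) (hγ2 : Summable fun k => γ k ^ 2) (hW : W ∈ doublyStochastic ℝ (Fin m))
    (hGH : G - H * G = 1 - averaging (Fin M)) (hG : ∀ s, ∑ t, |G s t| ≤ K) {v : Fin m} {R : ℝ}
    {N : ℕ} (hR : ∑ k ∈ Finset.range N, γ k * consensusBound W γ v k ≤ R) :
    ∑ k ∈ Finset.range N, γ k * ⟪gradient (objective f) (meanIterate W γ f x₀ a k),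
        gradient (localLoss f v) (meanIterate W γ f x₀ a k) - sampledGradient W γ f x₀ a k v⟫_ℝ ≤
      ∑ k ∈ Finset.range N, γ k * samplingNoise W γ f x₀ G H a k v +
      (2 * (B ^ 2 * K) * γ 0 + 2 * L * B ^ 2 * K * ∑' k, γ k ^ 2 + B ^ 2 * L * R) := by
  set Φ : ℕ → ℝ := fun k => corrector f G v (a k v) (meanIterate W γ f x₀ a k)
  have hK : 0 ≤ K := (Finset.sum_nonneg fun _ _ => abs_nonneg _).trans (hG (a 0 v))
  have htelescope := sum_mul_sub_le (Φ := Φ) hγ hγ0 (fun k => hf.abs_corrector_le hG v _ _) N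
  have hdrift : 2 * L * B ^ 2 * K * ∑ k ∈ Finset.range N, γ k ^ 2 ≤
      2 * L * B ^ 2 * K * ∑' k, γ k ^ 2 := by
    gcongr
    exact hγ2.sum_le_tsum _ fun k _ => sq_nonneg (γ k)
  have hconsensus := mul_le_mul_of_nonneg_left hR (by positivity : (0 : ℝ) ≤ B ^ 2 * L)
  refine (Finset.sum_le_sum fun k _ => mul_le_mul_of_nonneg_left
    (hf.inner_gradient_sub_sampledGradient_le hγ0 hW hGH hG k v) (hγ0 k)).trans ?_
  calc _ = ∑ k ∈ Finset.range N, γ k * samplingNoise W γ f x₀ G H a k v +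
        (∑ k ∈ Finset.range N, γ k * (Φ (k + 1) - Φ k) +
          2 * L * B ^ 2 * K * ∑ k ∈ Finset.range N, γ k ^ 2 +
          B ^ 2 * L * ∑ k ∈ Finset.range N, γ k * consensusBound W γ v k) := by
        simp only [Finset.mul_sum, ← Finset.sum_add_distrib]
        exact Finset.sum_congr rfl fun k _ => by ring
    _ ≤ _ := by gcongr

theorem sum_mul_norm_sq_le [NeZero m] (hf : IsRegular f B L) (hγ : Antitone γ)
    (hγ0 : ∀ k, 0 ≤ γ k) (hγ2 : Summable fun k => γ k ^ 2) (hW : W ∈ doublyStochastic ℝ (Fin m))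
    (hGH : G - H * G = 1 - averaging (Fin M)) (hG : ∀ s, ∑ t, |G s t| ≤ K) {Δ R : ℝ}
    (hΔ : ∀ y, objective f x₀ - objective f y ≤ Δ) {N : ℕ}
    (hR : ∀ v, ∑ k ∈ Finset.range N, γ k * consensusBound W γ v k ≤ R) :
    ∑ k ∈ Finset.range N, γ k * ‖gradient (objective f) (meanIterate W γ f x₀ a k)‖ ^ 2 ≤
      Δ + L * B ^ 2 / 2 * ∑' k, γ k ^ 2 +
      (2 * (B ^ 2 * K) * γ 0 + 2 * L * B ^ 2 * K * ∑' k, γ k ^ 2 + B ^ 2 * L * R) +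
      (1 / (m : ℝ)) * ∑ v, ∑ k ∈ Finset.range N, γ k * samplingNoise W γ f x₀ G H a k v := by
  set y := meanIterate W γ f x₀ a
  have hm : (m : ℝ) ≠ 0 := NeZero.ne _
  have hdecrease : ∑ k ∈ Finset.range N, (objective f (y k) - objective f (y (k + 1))) ≤ Δ := by
    rw [Finset.sum_range_sub', show y 0 = x₀ from meanIterate_zero]
    exact hΔ _
  have hquad : L * B ^ 2 / 2 * ∑ k ∈ Finset.range N, γ k ^ 2 ≤
      L * B ^ 2 / 2 * ∑' k, γ k ^ 2 := by
    gcongr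
    exact hγ2.sum_le_tsum _ fun k _ => sq_nonneg (γ k)
  have hinner := mul_le_mul_of_nonneg_left (Finset.sum_le_sum fun v (_ : v ∈ Finset.univ) =>
    hf.sum_mul_inner_le (x₀ := x₀) (a := a) hγ hγ0 hγ2 hW hGH hG (hR v))
    (by positivity : (0 : ℝ) ≤ 1 / m)
  rw [Finset.sum_add_distrib, Finset.sum_const, Finset.card_univ, Fintype.card_fin, nsmul_eq_mul,
    mul_add, ← mul_assoc (1 / (m : ℝ)) m, one_div_mul_cancel hm, one_mul, Finset.sum_comm] at hinner
  have hsum := Finset.sum_le_sum fun k (_ : k ∈ Finset.range N) =>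
    hf.stepsize_mul_norm_sq_le (x₀ := x₀) (a := a) hγ0 hW k
  rw [Finset.sum_add_distrib, Finset.sum_add_distrib, ← Finset.mul_sum, ← Finset.mul_sum] at hsum
  linarith

end IsRegular

end Trajectory

section Sampling

variable {m M : ℕ} {Ω : Type*} [MeasurableSpace Ω] {μ : Measure Ω}
  {H : Matrix (Fin M) (Fin M) ℝ} {j : ℕ → Fin m → Ω → Fin M}

theorem integral_comp_fintype [IsFiniteMeasure μ] {α : Type*} [Fintype α] [MeasurableSpace α]
    [MeasurableSingletonClass α] {X : Ω → α} (hX : Measurable X) (g : α → ℝ) :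
    ∫ ω, g (X ω) ∂μ = ∑ h, μ.real (X ⁻¹' {h}) * g h := by
  rw [← integral_map hX.aemeasurable Measurable.of_discrete.aestronglyMeasurable,
    integral_fintype Integrable.of_finite]
  simp only [map_measureReal_apply hX (measurableSet_singleton _), smul_eq_mul]

namespace IsMarkovSampling

theorem measurable_history (hj : IsMarkovSampling μ H j) (k : ℕ) :
    Measurable fun ω => (Set.Iic k).domRestrict fun i v => j i v ω :=
  measurable_pi_lambda _ fun i => measurable_pi_lambda _ fun v => hj.measurable i v

theorem integrable [IsFiniteMeasure μ] (hj : IsMarkovSampling μ H j)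
    {Φ : (ℕ → Fin m → Fin M) → ℝ} {k : ℕ} (hΦ : DependsOn Φ (Set.Iic k)) :
    Integrable (fun ω => Φ fun i v => j i v ω) μ := by
  obtain ⟨g, rfl⟩ := dependsOn_iff_exists_comp.1 hΦ
  exact (Integrable.of_finite (f := g)).comp_measurable (hj.measurable_history k)

theorem measureReal_history_next (hj : IsMarkovSampling μ H j) {k : ℕ}
    (h : Set.Iic k → Fin m → Fin M) (v : Fin m) (t : Fin M) :
    μ.real {ω | (Set.Iic k).domRestrict (fun i v => j i v ω) = h ∧ j (k + 1) v ω = t} =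
      μ.real {ω | (Set.Iic k).domRestrict (fun i v => j i v ω) = h} *
        H (h ⟨k, Set.self_mem_Iic⟩ v) t := by
  have : Nonempty (Fin m → Fin M) := ⟨h ⟨k, Set.self_mem_Iic⟩⟩
  obtain ⟨a, rfl⟩ := Subtype.surjective_restrict (β := fun _ => Fin m → Fin M)
    (ne := fun _ => this) (· ∈ Set.Iic k) h
  simpa [funext_iff, Set.domRestrict] using hj.markov k a v t

theorem integral_next [IsFiniteMeasure μ] (hj : IsMarkovSampling μ H j)
    {Φ : (ℕ → Fin m → Fin M) → Fin M → ℝ} {k : ℕ} (hΦ : DependsOn Φ (Set.Iic k)) (v : Fin m) :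
    ∫ ω, Φ (fun i u => j i u ω) (j (k + 1) v ω) ∂μ =
      ∫ ω, ∑ t, H (j k v ω) t * Φ (fun i u => j i u ω) t ∂μ := by
  obtain ⟨g, rfl⟩ := dependsOn_iff_exists_comp.1 hΦ
  have hhistory := hj.measurable_history k
  calc _ = ∑ h, ∑ t, μ.real ((fun ω => ((Set.Iic k).domRestrict fun i u => j i u ω,
        j (k + 1) v ω)) ⁻¹' {(h, t)}) * g h t := by
        rw [← Fintype.sum_prod_type']
        exact integral_comp_fintype (hhistory.prodMk (hj.measurable (k + 1) v)) fun p => g p.1 p.2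
    _ = ∑ h, μ.real ((fun ω => (Set.Iic k).domRestrict fun i u => j i u ω) ⁻¹' {h}) *
        ∑ t, H (h ⟨k, Set.self_mem_Iic⟩ v) t * g h t := by
        refine Finset.sum_congr rfl fun h _ => ?_
        rw [Finset.mul_sum]
        refine Finset.sum_congr rfl fun t _ => ?_
        rw [← mul_assoc]
        simpa [Set.preimage] using congrArg (· * g h t) (hj.measureReal_history_next h v t)
    _ = _ := (integral_comp_fintype hhistory
        fun h => ∑ t, H (h ⟨k, Set.self_mem_Iic⟩ v) t * g h t).symm

end IsMarkovSampling

end Sampling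

section Expectation

variable {m M n : ℕ} {W : Matrix (Fin m) (Fin m) ℝ} {γ : ℕ → ℝ}
  {f : Fin m → Fin M → Param n → ℝ} {x₀ : Param n} {G H : Matrix (Fin M) (Fin M) ℝ}

theorem dependsOn_meanIterate (k : ℕ) :
    DependsOn (fun a => meanIterate W γ f x₀ a k) (Set.Iio k) := fun _ _ h =>
  congrArg nodeAverage (iterate_congr h)

theorem dependsOn_comp_meanIterate {β : Type*} (F : Param n → β) (k : ℕ) :
    DependsOn (fun a => F (meanIterate W γ f x₀ a k)) (Set.Iic k) := fun _ _ h =>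
  congrArg F ((dependsOn_meanIterate k).mono Set.Iio_subset_Iic_self h)

variable {Ω : Type*} [MeasurableSpace Ω] {μ : Measure Ω} {j : ℕ → Fin m → Ω → Fin M} {B L : NNReal}

theorem dependsOn_sum_mul_corrector (k : ℕ) (v : Fin m) :
    DependsOn (fun a : ℕ → Fin m → Fin M => ∑ t, H (a k v) t *
      corrector f G v t (meanIterate W γ f x₀ a k)) (Set.Iic k) :=
    fun (a a' : ℕ → Fin m → Fin M) h => by
  have hmean : meanIterate W γ f x₀ a k = meanIterate W γ f x₀ a' k :=
    dependsOn_comp_meanIterate id k h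
  simp only [h k Set.self_mem_Iic, hmean]

theorem dependsOn_corrector_next (k : ℕ) (v : Fin m) :
    DependsOn (fun a : ℕ → Fin m → Fin M =>
      corrector f G v (a (k + 1) v) (meanIterate W γ f x₀ a k)) (Set.Iic (k + 1)) :=
    fun (a a' : ℕ → Fin m → Fin M) h => by
  have hmean : meanIterate W γ f x₀ a k = meanIterate W γ f x₀ a' k :=
    (dependsOn_comp_meanIterate id k).mono (Set.Iic_subset_Iic.2 k.le_succ) h
  simp only [h (k + 1) Set.self_mem_Iic, hmean]

namespace IsMarkovSampling

theorem integrable_comp_meanIterate [IsFiniteMeasure μ] (hj : IsMarkovSampling μ H j)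
    (F : Param n → ℝ) (k : ℕ) :
    Integrable (fun ω => F (meanIterate W γ f x₀ (fun i v => j i v ω) k)) μ :=
  hj.integrable (dependsOn_comp_meanIterate F k)

theorem integrable_samplingNoise [IsFiniteMeasure μ] (hj : IsMarkovSampling μ H j) (k : ℕ)
    (v : Fin m) :
    Integrable (fun ω => samplingNoise W γ f x₀ G H (fun i v => j i v ω) k v) μ :=
  (hj.integrable (dependsOn_sum_mul_corrector k v)).sub
    (hj.integrable (dependsOn_corrector_next k v))

theorem integral_samplingNoise [IsFiniteMeasure μ] (hj : IsMarkovSampling μ H j) (k : ℕ)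
    (v : Fin m) : ∫ ω, samplingNoise W γ f x₀ G H (fun i v => j i v ω) k v ∂μ = 0 := by
  simp only [samplingNoise]
  rw [integral_sub (hj.integrable (dependsOn_sum_mul_corrector k v))
    (hj.integrable (dependsOn_corrector_next k v)), sub_eq_zero]
  exact (hj.integral_next
    (dependsOn_comp_meanIterate (fun x t => corrector f G v t x) k) v).symm

theorem integral_sum_mul_samplingNoise [IsFiniteMeasure μ] (hj : IsMarkovSampling μ H j) (c : ℝ)
    (N : ℕ) :
    ∫ ω, c * ∑ v, ∑ k ∈ Finset.range N,
      γ k * samplingNoise W γ f x₀ G H (fun i v => j i v ω) k v ∂μ = 0 := by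
  have hint : ∀ v k, Integrable (fun ω => γ k *
      samplingNoise W γ f x₀ G H (fun i v => j i v ω) k v) μ := fun v k =>
    (hj.integrable_samplingNoise k v).const_mul _
  rw [integral_const_mul,
    integral_finsetSum _ fun v _ => integrable_finsetSum _ fun k _ => hint v k]
  simp only [integral_finsetSum _ fun k _ => hint _ k, integral_const_mul,
    hj.integral_samplingNoise, mul_zero, Finset.sum_const_zero]

end IsMarkovSampling

theorem sq_integral_le_integral_sq [IsProbabilityMeasure μ] {g : Ω → ℝ} (hg : Integrable g μ)
    (hg2 : Integrable (fun ω => g ω ^ 2) μ) : (∫ ω, g ω ∂μ) ^ 2 ≤ ∫ ω, g ω ^ 2 ∂μ :=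
  even_two.convexOn_pow.map_integral_le (continuous_pow 2).continuousOn isClosed_univ
    (Eventually.of_forall fun _ => Set.mem_univ _) hg hg2

namespace IsRegular

theorem sum_mul_sq_integral_norm_le [IsProbabilityMeasure μ] [NeZero m] (hf : IsRegular f B L)
    (hγ : Antitone γ) (hγ0 : ∀ k, 0 ≤ γ k) (hγ2 : Summable fun k => γ k ^ 2)
    (hW : W ∈ doublyStochastic ℝ (Fin m)) (hGH : G - H * G = 1 - averaging (Fin M)) {K : ℝ}
    (hG : ∀ s, ∑ t, |G s t| ≤ K) (hj : IsMarkovSampling μ H j) {Δ R : ℝ}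
    (hΔ : ∀ y, objective f x₀ - objective f y ≤ Δ) {N : ℕ}
    (hR : ∀ v, ∑ k ∈ Finset.range N, γ k * consensusBound W γ v k ≤ R) :
    ∑ k ∈ Finset.range N, γ k *
        (∫ ω, ‖gradient (objective f) (meanIterate W γ f x₀ (fun i v => j i v ω) k)‖ ∂μ) ^ 2 ≤
      Δ + L * B ^ 2 / 2 * ∑' k, γ k ^ 2 +
      (2 * (B ^ 2 * K) * γ 0 + 2 * L * B ^ 2 * K * ∑' k, γ k ^ 2 + B ^ 2 * L * R) := by
  set c := Δ + L * B ^ 2 / 2 * ∑' k, γ k ^ 2 +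
    (2 * (B ^ 2 * K) * γ 0 + 2 * L * B ^ 2 * K * ∑' k, γ k ^ 2 + B ^ 2 * L * R)
  set noise : Ω → ℝ := fun ω => (1 / (m : ℝ)) * ∑ v, ∑ k ∈ Finset.range N,
    γ k * samplingNoise W γ f x₀ G H (fun i v => j i v ω) k v
  have hnorm := hj.integrable_comp_meanIterate (W := W) (γ := γ) (f := f) (x₀ := x₀)
    fun x => ‖gradient (objective f) x‖
  have hsq := hj.integrable_comp_meanIterate (W := W) (γ := γ) (f := f) (x₀ := x₀)
    fun x => ‖gradient (objective f) x‖ ^ 2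
  have hnoise : Integrable noise μ := (integrable_finsetSum _ fun v _ =>
    integrable_finsetSum _ fun k _ => (hj.integrable_samplingNoise k v).const_mul _).const_mul _
  calc _ ≤ ∑ k ∈ Finset.range N, γ k * ∫ ω,
          ‖gradient (objective f) (meanIterate W γ f x₀ (fun i v => j i v ω) k)‖ ^ 2 ∂μ := by
        gcongr with k
        · exact hγ0 k
        · exact sq_integral_le_integral_sq (hnorm k) (hsq k)
    _ = ∫ ω, ∑ k ∈ Finset.range N, γ k *
          ‖gradient (objective f) (meanIterate W γ f x₀ (fun i v => j i v ω) k)‖ ^ 2 ∂μ := by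
        rw [integral_finsetSum _ fun k _ => (hsq k).const_mul _]
        simp only [integral_const_mul]
    _ ≤ ∫ ω, (c + noise ω) ∂μ :=
        integral_mono (integrable_finsetSum _ fun k _ => (hsq k).const_mul _)
          ((integrable_const c).add hnoise)
          fun ω => hf.sum_mul_norm_sq_le hγ hγ0 hγ2 hW hGH hG hΔ hR
    _ = c := by
        rw [integral_add (integrable_const c) hnoise, hj.integral_sum_mul_samplingNoise]
        simp

theorem abs_integral_norm_succ_sub_le [IsProbabilityMeasure μ] (hf : IsRegular f B L)
    (hγ : ∀ k, 0 ≤ γ k) (hW : W ∈ doublyStochastic ℝ (Fin m)) (hj : IsMarkovSampling μ H j)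
    (k : ℕ) :
    |(∫ ω, ‖gradient (objective f) (meanIterate W γ f x₀ (fun i v => j i v ω) (k + 1))‖ ∂μ) -
      ∫ ω, ‖gradient (objective f) (meanIterate W γ f x₀ (fun i v => j i v ω) k)‖ ∂μ| ≤
      L * B * γ k := by
  have hnorm := hj.integrable_comp_meanIterate (W := W) (γ := γ) (f := f) (x₀ := x₀)
    fun x => ‖gradient (objective f) x‖
  rw [← integral_sub (hnorm (k + 1)) (hnorm k), ← Real.norm_eq_abs]
  refine (norm_integral_le_of_norm_le_const (C := L * B * γ k)
    (Eventually.of_forall fun ω => ?_)).trans_eq (by simp)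
  rw [mul_assoc]
  exact (abs_norm_sub_norm_le _ _).trans (hf.lipschitzWith_gradient_objective.norm_sub_le_of_le
    (hf.norm_meanIterate_succ_sub_le hγ hW k))

end IsRegular

end Expectation

section Rate

variable {m M n : ℕ} {W : Matrix (Fin m) (Fin m) ℝ} {H : Matrix (Fin M) (Fin M) ℝ}
  {f : Fin m → Fin M → Param n → ℝ} {x₀ : Param n} {θ Δ : ℝ} {B L : NNReal}
  {Ω : Type*} [MeasurableSpace Ω] {μ : Measure Ω} {j : ℕ → Fin m → Ω → Fin M}

/-- The constant of the descent estimate with the dependence on the spectral gaps of the two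
matrices factored out; the numbers `24 * M` and `24 * m` come from the mixing bounds for the chain
and for the network. -/
def rateConstant (m M : ℕ) (θ : ℝ) (B L : NNReal) (Δ : ℝ) : ℝ :=
  Δ + L * B ^ 2 / 2 * ∑' k, stepsize θ k ^ 2 +
    (2 * (B ^ 2 * (24 * M)) + 2 * L * B ^ 2 * (24 * M) * ∑' k, stepsize θ k ^ 2 +
      B ^ 2 * L * (24 * m * ∑' k, stepsize θ k ^ 2))

theorem summable_stepsize_sq (hθ : 1 / 2 < θ) : Summable fun k => stepsize θ k ^ 2 :=
  summable_stepsize_pow_iff.2 (by push_cast; linarith)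

theorem one_le_one_div_one_sub_secondModulus {d : ℕ} {A : Matrix (Fin d) (Fin d) ℝ}
    (hρ : secondModulus A < 1) : 1 ≤ 1 / (1 - secondModulus A) :=
  one_le_one_div (sub_pos.2 hρ) (sub_le_self _ (secondModulus_nonneg A))

theorem expGradNorm_nonneg (k : ℕ) : 0 ≤ expGradNorm μ W θ f x₀ j k :=
  integral_nonneg fun _ => norm_nonneg _

theorem IsRegular.sum_stepsize_mul_expGradNorm_sq_le [IsProbabilityMeasure μ] [NeZero m] [NeZero M]
    (hf : IsRegular f B L) (hθ : 1 / 2 < θ) (hW : W ∈ doublyStochastic ℝ (Fin m))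
    (hH : H ∈ doublyStochastic ℝ (Fin M)) (hρW : secondModulus W < 1) (hρH : secondModulus H < 1)
    (hj : IsMarkovSampling μ H j) (hΔ : ∀ y, objective f x₀ - objective f y ≤ Δ) (N : ℕ) :
    ∑ k ∈ Finset.range N, stepsize θ k * expGradNorm μ W θ f x₀ j k ^ 2 ≤
      rateConstant m M θ B L Δ *
        (1 / (1 - secondModulus H) * (1 / (1 - secondModulus W))) ^ 2 := by
  have hγ := stepsize_antitone (θ := θ) (by linarith)
  have hγ2 := summable_stepsize_sq hθ
  have hsum := hf.sum_mul_sq_integral_norm_le hγ (stepsize_nonneg θ) hγ2 hW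
    (poissonSolution_sub_mul hH hρH) (sum_abs_poissonSolution_le hH hρH) hj hΔ (N := N)
    fun v => sum_mul_consensusBound_le hW hρW hγ (stepsize_nonneg θ) hγ2 v N
  have hΔ0 : 0 ≤ Δ := by simpa using hΔ x₀
  have hS : 0 ≤ ∑' k, stepsize θ k ^ 2 := tsum_nonneg fun _ => sq_nonneg _
  set S := ∑' k, stepsize θ k ^ 2
  set p := 1 / (1 - secondModulus H) with hp
  set q := 1 / (1 - secondModulus W) with hq
  have hp1 : 1 ≤ p ^ 2 := one_le_pow₀ (one_le_one_div_one_sub_secondModulus hρH)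
  have hq1 : 1 ≤ q ^ 2 := one_le_pow₀ (one_le_one_div_one_sub_secondModulus hρW)
  calc _ ≤ Δ + L * B ^ 2 / 2 * S +
        (2 * (B ^ 2 * (24 * M)) * p ^ 2 + 2 * L * B ^ 2 * (24 * M) * S * p ^ 2 +
          B ^ 2 * L * (24 * m * S) * q ^ 2) := by
        refine hsum.trans_eq ?_
        rw [stepsize_zero, div_eq_mul_one_div _ ((1 - secondModulus H) ^ 2),
          div_eq_mul_one_div _ ((1 - secondModulus W) ^ 2), ← one_div_pow, ← one_div_pow, ← hp,
          ← hq]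
        ring
    _ ≤ (Δ + L * B ^ 2 / 2 * S) * (p ^ 2 * q ^ 2) +
        (2 * (B ^ 2 * (24 * M)) * (p ^ 2 * q ^ 2) +
          2 * L * B ^ 2 * (24 * M) * S * (p ^ 2 * q ^ 2) +
          B ^ 2 * L * (24 * m * S) * (p ^ 2 * q ^ 2)) := by
        gcongr
        · exact le_mul_of_one_le_right (by positivity) (one_le_mul_of_one_le_of_one_le hp1 hq1)
        · exact le_mul_of_one_le_right (by positivity) hq1
        · exact le_mul_of_one_le_right (by positivity) hq1
        · exact le_mul_of_one_le_left (by positivity) hp1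
    _ = _ := by
        rw [rateConstant]
        ring

theorem IsRegular.tendsto_expGradNorm [IsProbabilityMeasure μ] [NeZero m] [NeZero M]
    (hf : IsRegular f B L) (hθ : 1 / 2 < θ) (hθ' : θ ≤ 1) (hW : W ∈ doublyStochastic ℝ (Fin m))
    (hH : H ∈ doublyStochastic ℝ (Fin M)) (hρW : secondModulus W < 1) (hρH : secondModulus H < 1)
    (hj : IsMarkovSampling μ H j) (hΔ : ∀ y, objective f x₀ - objective f y ≤ Δ) :
    Tendsto (expGradNorm μ W θ f x₀ j) atTop (𝓝 0) := by
  have hdiv : ¬ Summable (stepsize θ) := by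
    simpa using (summable_stepsize_pow_iff (θ := θ) (p := 1)).not.2 (by simpa using hθ')
  have hγ3 : Summable fun k => stepsize θ k ^ 3 :=
    summable_stepsize_pow_iff.2 (by push_cast; linarith)
  exact tendsto_zero_of_summable_mul_sq hdiv hγ3 expGradNorm_nonneg
    (hf.abs_integral_norm_succ_sub_le (stepsize_nonneg θ) hW hj)
    (summable_of_sum_range_le (fun k => mul_nonneg (stepsize_nonneg θ k) (sq_nonneg _))
      (hf.sum_stepsize_mul_expGradNorm_sq_le hθ hW hH hρW hρH hj hΔ))

theorem IsRegular.inf'_expGradNorm_le [IsProbabilityMeasure μ] [NeZero m] [NeZero M]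
    (hf : IsRegular f B L) (hθ : 1 / 2 < θ) (hθ' : θ ≤ 1) (hW : W ∈ doublyStochastic ℝ (Fin m))
    (hH : H ∈ doublyStochastic ℝ (Fin M)) (hρW : secondModulus W < 1) (hρH : secondModulus H < 1)
    (hj : IsMarkovSampling μ H j) (hΔ : ∀ y, objective f x₀ - objective f y ≤ Δ) {k : ℕ}
    (hk : 1 ≤ k) :
    (Finset.Icc 1 k).inf' (Finset.nonempty_Icc.2 hk) (expGradNorm μ W θ f x₀ j) ≤
      √(2 * rateConstant m M θ B L Δ) *
        ((1 / Real.log (1 / mixingRate H)) * (1 / (1 - secondModulus W)) /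
          (k : ℝ) ^ ((1 - θ) / 2)) := by
  have hp : 0 ≤ 1 / (1 - secondModulus H) :=
    zero_le_one.trans (one_le_one_div_one_sub_secondModulus hρH)
  have hq : 0 ≤ 1 / (1 - secondModulus W) :=
    zero_le_one.trans (one_le_one_div_one_sub_secondModulus hρW)
  calc _ ≤ √(2 * (rateConstant m M θ B L Δ *
          (1 / (1 - secondModulus H) * (1 / (1 - secondModulus W))) ^ 2)) /
          (k : ℝ) ^ ((1 - θ) / 2) :=
        inf'_le_of_sum_stepsize_mul_sq_le (by linarith) hθ' expGradNorm_nonneg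
          (hf.sum_stepsize_mul_expGradNorm_sq_le hθ hW hH hρW hρH hj hΔ) hk
    _ = √(2 * rateConstant m M θ B L Δ) *
          (1 / (1 - secondModulus H) * (1 / (1 - secondModulus W)) /
            (k : ℝ) ^ ((1 - θ) / 2)) := by
        rw [← mul_assoc, Real.sqrt_mul' _ (sq_nonneg _), Real.sqrt_sq (mul_nonneg hp hq),
          mul_div_assoc]
    _ ≤ _ := by
        gcongr ?_ * (?_ * _ / _)
        exact one_div_one_sub_secondModulus_le hρH

end Rate

end DMGD

end

theorem theorem1_general (m M : ℕ) (θ : ℝ) (hθ : 1 / 2 < θ) (hθ' : θ ≤ 1) (B L Δ : ℝ) :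
    ∃ C : ℝ, 0 < m → ∀ (n : ℕ) (f : Fin m → Fin M → DMGD.Param n → ℝ) (x₀ : DMGD.Param n),
      (∀ v s, Differentiable ℝ (f v s)) →
      (∀ y, DMGD.objective f x₀ - DMGD.objective f y ≤ Δ) →
      (∀ v s x, ‖gradient (f v s) x‖ ≤ B) →
      (∀ v s x y, ‖gradient (f v s) x - gradient (f v s) y‖ ≤ L * ‖x - y‖) →
      ∀ W ∈ doublyStochastic ℝ (Fin m), W.IsPrimitive →
      ∀ H ∈ doublyStochastic ℝ (Fin M), H.IsPrimitive →
      ∀ (Ω : Type*) [MeasurableSpace Ω] (μ : Measure Ω) [IsProbabilityMeasure μ]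
        (j : ℕ → Fin m → Ω → Fin M), DMGD.IsMarkovSampling μ H j →
      Tendsto (fun k => DMGD.expGradNorm μ W θ f x₀ j k) atTop (𝓝 0) ∧
      DMGD.mixingRate H ∈ Set.Ico (0 : ℝ) 1 ∧
      ∀ (k : ℕ) (hk : 1 ≤ k),
        (Finset.Icc 1 k).inf' (Finset.nonempty_Icc.2 hk)
            (fun i => DMGD.expGradNorm μ W θ f x₀ j i) ≤
          C * ((1 / Real.log (1 / DMGD.mixingRate H)) * (1 / (1 - DMGD.secondModulus W)) /
            (k : ℝ) ^ ((1 - θ) / 2)) := by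
  refine ⟨√(2 * DMGD.rateConstant m M θ B.toNNReal L.toNNReal Δ),
    fun hm n f x₀ hdiff hΔ hB hL W hW hWprim H hH hHprim Ω _ μ _ j hj => ?_⟩
  have : NeZero m := ⟨hm.ne'⟩
  obtain ⟨ω⟩ := nonempty_of_isProbabilityMeasure μ
  have : NeZero M := ⟨(Fin.pos (j 0 ⟨0, hm⟩ ω)).ne'⟩
  have hf : DMGD.IsRegular f B.toNNReal L.toNNReal :=
    { diff := hdiff
      bound := fun v s x => (hB v s x).trans (Real.le_coe_toNNReal B)
      lip := fun v s => LipschitzWith.of_dist_le' fun x y => by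
        simpa only [dist_eq_norm] using hL v s x y }
  have hρW := DMGD.secondModulus_lt_one hW hWprim
  have hρH := DMGD.secondModulus_lt_one hH hHprim
  exact ⟨hf.tendsto_expGradNorm hθ hθ' hW hH hρW hρH hj hΔ, DMGD.mixingRate_mem_Ico hρH,
    fun k hk => hf.inf'_expGradNorm_le hθ hθ' hW hH hρW hρH hj hΔ hk⟩

theorem theorem1 (m M : ℕ) (θ : ℝ) (hθ : 1 / 2 < θ) (hθ' : θ < 1) (B L Δ : ℝ) :
    -- the constant depends only on the numbers of nodes and samples, `θ`, `B`, `L` and `Δ`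
    ∃ C : ℝ, ∀ (n : ℕ) (f : Fin m → Fin M → DMGD.Param n → ℝ) (x₀ : DMGD.Param n),
      (∀ v s, Differentiable ℝ (f v s)) →
      -- lower bounded losses; `Δ` is any bound of the initial gap
      (∀ v, BddBelow (Set.range (DMGD.localLoss f v))) →
      (∀ y, DMGD.objective f x₀ - DMGD.objective f y ≤ Δ) →
      -- bounded and Lipschitz gradients
      (∀ v s x, ‖gradient (f v s) x‖ ≤ B) →
      (∀ v s x y, ‖gradient (f v s) x - gradient (f v s) y‖ ≤ L * ‖x - y‖) →
      -- connected network and mixing matrix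
      ∀ (G : SimpleGraph (Fin m)) (W : Matrix (Fin m) (Fin m) ℝ),
      G.Connected → DMGD.IsMixingMatrix G W →
      -- transition matrix of the Markov chains, with the uniform stationary distribution
      ∀ (H : Matrix (Fin M) (Fin M) ℝ),
      DMGD.IsTransitionMatrix H → DMGD.IsIrreducible H → DMGD.IsAperiodic H →
      DMGD.IsStationary H (fun _ => 1 / (M : ℝ)) →
      ∀ (Ω : Type*) [MeasurableSpace Ω] (μ : Measure Ω) [IsProbabilityMeasure μ]
        (j : ℕ → Fin m → Ω → Fin M), DMGD.IsMarkovSampling μ H j →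
      Tendsto (fun k => DMGD.expGradNorm μ W θ f x₀ j k) atTop (𝓝 0) ∧
      DMGD.mixingRate H ∈ Set.Ico (0 : ℝ) 1 ∧
      ∀ (k : ℕ) (hk : 1 ≤ k),
        (Finset.Icc 1 k).inf' (Finset.nonempty_Icc.2 hk)
            (fun i => DMGD.expGradNorm μ W θ f x₀ j i) ≤
          C * ((1 / Real.log (1 / DMGD.mixingRate H)) * (1 / (1 - DMGD.secondModulus W)) /
            (k : ℝ) ^ ((1 - θ) / 2)) := by
  obtain ⟨C, hC⟩ := theorem1_general m M θ hθ hθ'.le B L Δ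
  exact ⟨C, fun n f x₀ hdiff _ hΔ hB hL _ W hG hW H hH hirr hap hs =>
    hC (Fin.pos_iff_nonempty.2 hG.nonempty) n f x₀ hdiff hΔ hB hL W hW.mem_doublyStochastic
      (hW.isPrimitive hG) H (hs.mem_doublyStochastic hH) (hirr.isPrimitive hap hH.1)⟩
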